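/- Let $n,m\ge 1$ be integers, let $\mathbb B^m$ be the open unit ball of $\mathbb C^m$ and $\langle z,w\rangle=\sum_j z_j\overline{w}_j$. Let $H_n^2$ be the Hilbert space of functions on $\mathbb B^m$ with reproducing kernel $(1-\langle z,w\rangle)^{-n}$; the coordinate functions act on it by bounded multiplication operators $S_i f=z_i f$, and $\mathbf S^*=(S_1^*,\dots,S_m^*)$ denotes the adjoint tuple. Notions. A commuting tuple $\mathbf T=(T_1,\dots,T_m)$ of bounded operators on a Hilbert space $\mathcal H$ lies in the Cowen–Douglas class $\mathcal B_1^m(\mathbb B^m)$ if for every $w\in\mathbb B^m$ the range of $x\mapsto((T_1-w_1)x,\dots,(T_m-w_m)x)$ is closed in $\mathcal H^m$ and the joint kernel $\ker(\mathbf T-w)=\bigcap_i\ker(T_i-w_i)$ is one-dimensional, and if these joint kernels together span a dense subspace of $\mathcal H$. Its curvature is $$\mathcal K_{\mathbf T}(w)=-\sum_{i,j=1}^m\frac{\partial^2\log\|\gamma(w)\|^2}{\partial w_i\,\partial\overline w_j}\,dw_i\wedge d\overline w_j ,$$ where $\gamma:\mathbb B^m\to\mathcal H$ is holomorphic, nowhere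 zero, with $\gamma(w)\in\ker(\mathbf T-w)$. The tuple $\mathbf T$ is an $n$-hypercontraction if $(I-\mathbf M_{\mathbf T})^k(I)\ge 0$ for $1\le k\le n$, where $\mathbf M_{\mathbf T}(X)=\sum_{i=1}^m T_i^*XT_i$. Two tuples $\mathbf T,\mathbf T'$ are similar if there is a bounded invertible operator $X$ with $XT_i=T_i'X$ for all $i$. Statement. We have $\mathbf S^*\in\mathcal B_1^m(\mathbb B^m)$, and there are positive numbers $a(0),a(1),\dots$ such that $K(z,w)=\sum_{i\ge0}a(i)\langle z,w\rangle^i$ converges on $\mathbb B^m$, the coordinate functions act by bounded multiplication operators on the Hilbert space with reproducing kernel $K$, and the tuple $\mathbf T=(T_1,\dots,T_m)$ of the adjoints of these operators has the following properties: 1. $\mathbf T\in\mathcal B_1^m(\mathbb B^m)$, and $\mathbf T$ is not an $n$-hypercontraction; 2. there is a positive, bounded, real-analytic function $\varphi$ on $\mathbb B^m$ such that $$\mathcal K_{\mathbf S^*}(w)-\mathcal K_{\mathbf T}(w)=\sum_{i,j=1}^m\frac{\partial^2\varphi(w)}{\partial w_i\,\partial\overline w_j}\,dw_i\wedge d\overline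 w_j,\qquad w\in\mathbb B^m;$$ 3. $\mathbf T$ is not similar to $\mathbf S^*$. -/

import Mathlib

open scoped ComplexConjugate InnerProductSpace ComplexOrder Matrix

noncomputable section

/-! ### The ball and the radial reproducing kernels -/

/-- The Hermitian space `ℂ^m`. -/
abbrev Cm (m : ℕ) : Type := EuclideanSpace ℂ (Fin m)

/-- The open unit ball of `ℂ^m`, as a set. -/
def unitBall (m : ℕ) : Set (Cm m) := Metric.ball 0 1

/-- The operator-valued form `K(z, w) • id` of a scalar kernel `K`, which is the shape in which
`RKHS` takes a kernel; the Hilbert spaces here consist of complex-valued functions. -/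
def scalarKernel {X : Type*} (k : Matrix X X ℂ) : Matrix X X (ℂ →L[ℂ] ℂ) :=
  Matrix.of fun x y => k x y • ContinuousLinearMap.id ℂ ℂ

theorem scalarKernel_posSemidef {X : Type*} {k : Matrix X X ℂ} (hk : k.PosSemidef) :
    (scalarKernel k).PosSemidef := by
  have key := (RKHS.posSemidef_tfae (𝕜 := ℂ) (V := ℂ) (K := scalarKernel k)).out 0 2
  rw [key]
  refine ⟨?_, fun v => ?_⟩
  · ext x y
    have h := hk.1.apply x y
    simp only [Matrix.conjTranspose_apply, scalarKernel, Matrix.of_apply, star_smul]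
    rw [h, ContinuousLinearMap.star_eq_adjoint, ContinuousLinearMap.adjoint_id]
  · have h := (RCLike.nonneg_iff.mp (hk.2 v)).1
    refine h.trans_eq (congrArg RCLike.re ?_)
    refine Finset.sum_congr rfl fun x _ => Finset.sum_congr rfl fun y _ => ?_
    have h' := hk.1.apply x y
    simp only [scalarKernel, Matrix.of_apply, FunLike.coe_smul, Pi.smul_apply,
      ContinuousLinearMap.id_apply, smul_eq_mul, RCLike.inner_apply, map_mul]
    rw [← h']
    simp only [RCLike.star_def]
    ring

/-- The powers `⟨z, w⟩ ^ i`, where `⟨z, w⟩ = ∑ j, z j * conj (w j)`, are positive semidefinite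
kernels.  (Mathlib's `⟪w, z⟫_ℂ` is linear in `z`.) -/
theorem innerPow_posSemidef (m i : ℕ) :
    (Matrix.of fun z w : unitBall m => ⟪(w : Cm m), (z : Cm m)⟫_ℂ ^ i).PosSemidef := by
  have hg : (Matrix.of fun z w : unitBall m => ⟪(w : Cm m), (z : Cm m)⟫_ℂ).PosSemidef := by
    refine ⟨?_, fun x => ?_⟩
    · ext z w
      simp only [Matrix.conjTranspose_apply, Matrix.of_apply, RCLike.star_def]
      exact inner_conj_symm _ _
    · have h : (x.sum fun z c => x.sum fun w d => star c * ⟪(w : Cm m), (z : Cm m)⟫_ℂ * d) =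
          ⟪∑ w ∈ x.support, star (x w) • (w : Cm m),
            ∑ z ∈ x.support, star (x z) • (z : Cm m)⟫_ℂ := by
        simp only [Finsupp.sum, inner_sum, sum_inner, inner_smul_left, inner_smul_right,
          RCLike.star_def, Complex.conj_conj, Finset.mul_sum]
        refine Finset.sum_congr rfl fun z _ => Finset.sum_congr rfl fun w _ => ?_
        ring
      have h' : 0 ≤ ⟪∑ w ∈ x.support, star (x w) • (w : Cm m),
          ∑ z ∈ x.support, star (x z) • (z : Cm m)⟫_ℂ :=
        RCLike.nonneg_iff.mpr ⟨inner_self_nonneg, inner_self_im _⟩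
      exact h'.trans_eq h.symm
  induction i with
  | zero =>
    refine ⟨?_, fun x => ?_⟩
    · ext z w
      simp
    · have h : (x.sum fun z c => x.sum fun w d =>
          star c * (⟪(w : Cm m), (z : Cm m)⟫_ℂ ^ 0) * d) =
          star (∑ z ∈ x.support, x z) * ∑ w ∈ x.support, x w := by
        simp only [Finsupp.sum, pow_zero, mul_one, star_sum, Finset.sum_mul_sum]
      exact (star_mul_self_nonneg _).trans_eq h.symm
  | succ i ih =>
    have h := Matrix.PosSemidef.hadamard (𝕜 := ℂ) ih hg
    have e : (Matrix.of fun z w : unitBall m => ⟪(w : Cm m), (z : Cm m)⟫_ℂ ^ (i + 1)) =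
        Matrix.hadamard (Matrix.of fun z w : unitBall m => ⟪(w : Cm m), (z : Cm m)⟫_ℂ ^ i)
          (Matrix.of fun z w : unitBall m => ⟪(w : Cm m), (z : Cm m)⟫_ℂ) := by
      ext z w
      simp [pow_succ]
    rw [e]
    exact h

/-- A sequence `a(0), a(1), …` of positive numbers for which the radial kernel
`∑ i, a(i) ⟨z, w⟩ ^ i` converges on the unit ball. -/
structure RadialWeight where
  /-- the coefficients -/
  coeff : ℕ → ℝ
  pos : ∀ i, 0 < coeff i
  summable : ∀ r : ℝ, 0 ≤ r → r < 1 → Summable fun i => coeff i * r ^ i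

theorem norm_inner_lt_one {m : ℕ} (z w : unitBall m) : ‖⟪(w : Cm m), (z : Cm m)⟫_ℂ‖ < 1 := by
  have hz : ‖(z : Cm m)‖ < 1 := by simpa [unitBall] using z.2
  have hw : ‖(w : Cm m)‖ < 1 := by simpa [unitBall] using w.2
  calc _ ≤ ‖(w : Cm m)‖ * ‖(z : Cm m)‖ := norm_inner_le_norm _ _
    _ < 1 := by nlinarith [norm_nonneg (z : Cm m), norm_nonneg (w : Cm m)]

theorem RadialWeight.summable_kernel (a : RadialWeight) {m : ℕ} (z w : unitBall m) :
    Summable fun i => (a.coeff i : ℂ) * ⟪(w : Cm m), (z : Cm m)⟫_ℂ ^ i := by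
  refine Summable.of_norm ?_
  refine (a.summable _ (norm_nonneg _) (norm_inner_lt_one z w)).congr fun i => ?_
  rw [norm_mul, norm_pow, Complex.norm_real, Real.norm_of_nonneg (a.pos i).le]

/-- The kernel `K(z, w) = ∑ i, a(i) ⟨z, w⟩ ^ i` on the unit ball. -/
def RadialWeight.kernel (a : RadialWeight) (m : ℕ) : Matrix (unitBall m) (unitBall m) ℂ :=
  Matrix.of fun z w => ∑' i, (a.coeff i : ℂ) * ⟪(w : Cm m), (z : Cm m)⟫_ℂ ^ i

theorem RadialWeight.kernel_posSemidef (a : RadialWeight) (m : ℕ) :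
    (a.kernel m).PosSemidef := by
  have hs : ∀ z w : unitBall m,
      HasSum (fun i => (a.coeff i : ℂ) * ⟪(w : Cm m), (z : Cm m)⟫_ℂ ^ i) (a.kernel m z w) :=
    fun z w => (a.summable_kernel z w).hasSum
  refine ⟨?_, fun x => ?_⟩
  · ext z w
    simp only [Matrix.conjTranspose_apply, RadialWeight.kernel, Matrix.of_apply, tsum_star]
    congr 1
    funext i
    simp
  · have hq : HasSum (fun i => x.sum fun z c => x.sum fun w d =>
        star c * ((a.coeff i : ℂ) * ⟪(w : Cm m), (z : Cm m)⟫_ℂ ^ i) * d)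
        (x.sum fun z c => x.sum fun w d => star c * a.kernel m z w * d) :=
      hasSum_sum fun z _ => hasSum_sum fun w _ => ((hs z w).mul_left _).mul_right _
    refine hq.nonneg fun i => ?_
    have h := (innerPow_posSemidef m i).2 x
    have ha : (0 : ℂ) ≤ (a.coeff i : ℂ) := by exact_mod_cast (a.pos i).le
    have h2 := mul_nonneg ha h
    refine h2.trans_eq ?_
    simp only [Finsupp.sum, Finset.mul_sum, Matrix.of_apply]
    refine Finset.sum_congr rfl fun z _ => Finset.sum_congr rfl fun w _ => ?_
    ring

instance RadialWeight.factPosSemidef (a : RadialWeight) (m : ℕ) :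
    Fact (scalarKernel (a.kernel m)).PosSemidef :=
  ⟨scalarKernel_posSemidef (a.kernel_posSemidef m)⟩

/-- The Hilbert space of functions on the unit ball of `ℂ^m` with reproducing kernel
`∑ i, a(i) ⟨z, w⟩ ^ i`. -/
abbrev RadialWeight.Space (a : RadialWeight) (m : ℕ) : Type :=
  RKHS.OfKernel (scalarKernel (a.kernel m))

/-- The kernel `(1 - ⟨z, w⟩)⁻ⁿ` on the unit ball. -/
def hardyKernel (n m : ℕ) : Matrix (unitBall m) (unitBall m) ℂ :=
  Matrix.of fun z w => ((1 - ⟪(w : Cm m), (z : Cm m)⟫_ℂ) ^ n)⁻¹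

theorem hardyKernel_posSemidef (n m : ℕ) : (hardyKernel n m).PosSemidef := by
  cases n with
  | zero =>
    convert innerPow_posSemidef m 0 using 1
    ext z w
    simp [hardyKernel]
  | succ k =>
    let a : RadialWeight :=
      { coeff := fun i => ((i + k).choose k : ℝ)
        pos := fun i => by exact_mod_cast Nat.choose_pos (Nat.le_add_left k i)
        summable := fun r h0 h1 =>
          summable_choose_mul_geometric_of_norm_lt_one k (by rwa [Real.norm_of_nonneg h0]) }
    convert a.kernel_posSemidef m using 1
    ext z w
    have h := tsum_choose_mul_geometric_of_norm_lt_one k (norm_inner_lt_one z w)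
    simp only [hardyKernel, RadialWeight.kernel, Matrix.of_apply, a]
    rw [← one_div, ← h]
    simp

instance factHardyPosSemidef (n m : ℕ) : Fact (scalarKernel (hardyKernel n m)).PosSemidef :=
  ⟨scalarKernel_posSemidef (hardyKernel_posSemidef n m)⟩

/-- The space `H²ₙ`: the Hilbert space of functions on the unit ball of `ℂ^m` with reproducing
kernel `(1 - ⟨z, w⟩)⁻ⁿ`. -/
abbrev HardySpace (n m : ℕ) : Type := RKHS.OfKernel (scalarKernel (hardyKernel n m))

/-! ### Tuples of operators -/

section Tuples

variable {m : ℕ} {H : Type*} [NormedAddCommGroup H] [InnerProductSpace ℂ H]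

/-- `M` is the tuple of multiplication operators by the coordinate functions on a Hilbert space of
functions on the unit ball: `(M i f)(z) = z i * f z`. -/
def IsCoordinateMultiplication [RKHS ℂ H (unitBall m) ℂ] (M : Fin m → H →L[ℂ] H) : Prop :=
  ∀ (i : Fin m) (f : H) (z : unitBall m), M i f z = (z : Cm m) i * f z

/-- The multiplication tuple is unique. -/
theorem IsCoordinateMultiplication.unique [RKHS ℂ H (unitBall m) ℂ] {M N : Fin m → H →L[ℂ] H}
    (hM : IsCoordinateMultiplication M) (hN : IsCoordinateMultiplication N) : M = N := by
  funext i
  ext1 f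
  exact RKHS.ext fun z => (hM i f z).trans (hN i f z).symm

/-- The adjoint tuple `(T₁*, …, Tₘ*)`. -/
def adjointTuple [CompleteSpace H] (T : Fin m → H →L[ℂ] H) : Fin m → H →L[ℂ] H :=
  fun i => ContinuousLinearMap.adjoint (T i)

/-- The joint kernel `⋂ i, ker (T i - w i)`. -/
def jointKer (T : Fin m → H →L[ℂ] H) (w : Cm m) : Submodule ℂ H :=
  ⨅ i, LinearMap.ker ((T i - w i • ContinuousLinearMap.id ℂ H : H →L[ℂ] H) : H →ₗ[ℂ] H)

/-- The Cowen–Douglas class of rank `k` over the connected open set `Ω`. -/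
structure CowenDouglas (k : ℕ) (Ω : Set (Cm m)) (T : Fin m → H →L[ℂ] H) : Prop where
  comm : ∀ i j, T i ∘L T j = T j ∘L T i
  /-- the range of `T - w : x ↦ ((T₁ - w₁) x, …, (Tₘ - wₘ) x)` is closed -/
  isClosed_range : ∀ w ∈ Ω, IsClosed (Set.range fun (x : H) (i : Fin m) => T i x - w i • x)
  dense_span : (⨆ w ∈ Ω, jointKer T w).topologicalClosure = ⊤
  finrank_jointKer : ∀ w ∈ Ω, Module.finrank ℂ (jointKer T w) = k

/-- The map `X ↦ ∑ i, Tᵢ* X Tᵢ` on operators. -/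
def conjugationMap [CompleteSpace H] (T : Fin m → H →L[ℂ] H) :
    Module.End ℂ (H →L[ℂ] H) :=
  ∑ i, LinearMap.mulLeft ℂ (ContinuousLinearMap.adjoint (T i)) ∘ₗ LinearMap.mulRight ℂ (T i)

/-- `T` is an `n`-hypercontraction: `(1 - M_T)^k (I) ≥ 0` for `1 ≤ k ≤ n`, where
`M_T X = ∑ i, Tᵢ* X Tᵢ`. -/
def IsHypercontraction [CompleteSpace H] (n : ℕ) (T : Fin m → H →L[ℂ] H) : Prop :=
  ∀ k, 1 ≤ k → k ≤ n →
    (((1 - conjugationMap T) ^ k) (ContinuousLinearMap.id ℂ H)).IsPositive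

/-- The tuples `T` and `S` are similar: one invertible bounded operator `X` satisfies
`X Tᵢ = Sᵢ X` for all `i`. -/
def IsSimilar {H' : Type*} [NormedAddCommGroup H'] [InnerProductSpace ℂ H']
    (T : Fin m → H →L[ℂ] H) (S : Fin m → H' →L[ℂ] H') : Prop :=
  ∃ X : H ≃L[ℂ] H', ∀ i x, X (T i x) = S i (X x)

end Tuples

/-! ### Forms of type (1,1) and curvature -/

section Curvature

variable {m : ℕ}

/-- The Wirtinger derivative `∂f/∂wᵢ = (∂f/∂xᵢ - I ∂f/∂yᵢ) / 2`. -/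
def wirtinger (i : Fin m) (f : Cm m → ℂ) (w : Cm m) : ℂ :=
  (fderiv ℝ f w (EuclideanSpace.single i 1) -
    Complex.I * fderiv ℝ f w (EuclideanSpace.single i Complex.I)) / 2

/-- The Wirtinger derivative `∂f/∂w̄ᵢ = (∂f/∂xᵢ + I ∂f/∂yᵢ) / 2`. -/
def wirtingerBar (i : Fin m) (f : Cm m → ℂ) (w : Cm m) : ℂ :=
  (fderiv ℝ f w (EuclideanSpace.single i 1) +
    Complex.I * fderiv ℝ f w (EuclideanSpace.single i Complex.I)) / 2

/-- The value at `w` of `∑ i j, ∂²u/∂wᵢ∂w̄ⱼ dwᵢ ∧ dw̄ⱼ`, as a form in two tangent vectors. -/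
def ddbar (u : Cm m → ℝ) (w : Cm m) : Cm m → Cm m → ℂ := fun ξ η =>
  ∑ i, ∑ j, wirtinger i (wirtingerBar j fun v => (u v : ℂ)) w *
    (ξ i * conj (η j) - η i * conj (ξ j))

variable {H : Type*} [NormedAddCommGroup H] [InnerProductSpace ℂ H]

/-- `γ` is a non-vanishing holomorphic section over `Ω` of the bundle with fibre
`jointKer T w` at `w`. -/
structure IsNonvanishingSection (T : Fin m → H →L[ℂ] H) (Ω : Set (Cm m)) (γ : Cm m → H) :
    Prop where
  holomorphic : DifferentiableOn ℂ γ Ω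
  mem : ∀ w ∈ Ω, γ w ∈ jointKer T w
  ne_zero : ∀ w ∈ Ω, γ w ≠ 0

/-- `κ` is the curvature over `Ω` of the tuple `T` of rank one:
`κ(w) = -∑ i j, ∂² log ‖γ(w)‖² / ∂wᵢ∂w̄ⱼ dwᵢ ∧ dw̄ⱼ` for a non-vanishing holomorphic section `γ`
(the form does not depend on `γ`). -/
def IsCurvature (T : Fin m → H →L[ℂ] H) (Ω : Set (Cm m)) (κ : Cm m → Cm m → Cm m → ℂ) : Prop :=
  ∃ γ : Cm m → H, IsNonvanishingSection T Ω γ ∧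
    ∀ w ∈ Ω, κ w = -ddbar (fun v => Real.log (‖γ v‖ ^ 2)) w

end Curvature

end

/-! With `p = n - 1`, the kernel of `HardySpace n m` has the coefficients `b(k) = (k+p).choose p`.
The second kernel has `a(k) = b(k) * (1 + tents k)`, where `tents` is unbounded and 1-Lipschitz,
with spikes so sparse that its averages stay bounded.

Averages control the kernels: `∑_{k<N} a(k) ≤ (4p+5) ∑_{k<N} b(k)` for every `N` passes to the power
series by Abel summation. Hence the quotient of the two kernels on the diagonal lies in `[1, 4p+5]`,
and `φ = 1 + log` of this quotient is a bounded positive potential for the difference of curvatures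
(`exists_curvature_potential`).

Individual coefficients control the operators. A similarity would bound `a(k)/b(k)`
(`coeff_le_of_isSimilar`), which the spikes forbid. A hypercontraction would make `a` monotone
(`coeff_le_of_isHypercontraction`), and a monotone sequence with dominated averages is itself
dominated by `b`, because `b` is doubling (`not_monotone_spikedWeight`).

Membership in the Cowen–Douglas class is proved for both weights at once. The function space embeds
isometrically in the full Fock space, where the adjoint tuple becomes weighted deletion of the first
letter (`lower`). The weighted creations (`raise`) satisfy `∑ raise i ∘ lower i = 1 - (rank one)`,
and `1 - ∑ w i • raise i` is invertible on the ball. Together they give a left inverse of `T - w`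
modulo rank one (`sum_regularizer`); the joint kernels, the closed ranges and a holomorphic section
all follow from it. -/

noncomputable section

/-! ### The full Fock space and weighted shifts -/

section Fock

variable {m : ℕ}

/-- The full Fock space over `ℂ^m`: square summable families indexed by words. -/
abbrev Fock (m : ℕ) : Type := lp (fun _ : List (Fin m) => ℂ) 2

namespace Fock

theorem hasSum_norm_sq (g : Fock m) : HasSum (fun α => ‖g α‖ ^ 2) (‖g‖ ^ 2) := by
  have h := lp.hasSum_norm (p := 2) (by norm_num) g
  simpa using h

theorem memℓp_of_summable {f : List (Fin m) → ℂ} (hf : Summable fun α => ‖f α‖ ^ 2) :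
    Memℓp f 2 := by
  apply memℓp_gen
  simpa using hf

theorem norm_le_of_forall_norm_le {g h : Fock m} {c : ℝ} (hc : 0 ≤ c)
    (H : ∀ α, ‖g α‖ ≤ c * ‖h α‖) : ‖g‖ ≤ c * ‖h‖ := by
  refine abs_le_of_sq_le_sq' ?_ (by positivity) |>.2
  rw [mul_pow]
  refine hasSum_le (fun α => ?_) (hasSum_norm_sq g) ((hasSum_norm_sq h).mul_left (c ^ 2))
  rw [← mul_pow]
  exact pow_le_pow_left₀ (norm_nonneg _) (H α) 2

theorem smul_apply (c : ℂ) (g : Fock m) (α : List (Fin m)) : (c • g) α = c * g α := rfl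

theorem coe_sum_apply {ι : Type*} (s : Finset ι) (f : ι → Fock m) (α : List (Fin m)) :
    (∑ i ∈ s, f i) α = ∑ i ∈ s, f i α := by
  rw [lp.coeFn_sum, Finset.sum_apply]

theorem summable_cons (g : Fock m) (i : Fin m) : Summable fun α => ‖g (i :: α)‖ ^ 2 :=
  (hasSum_norm_sq g).summable.comp_injective (i := fun α => i :: α) List.cons_injective

/-- The backward shift which deletes a leading letter `i`, with weights depending on the length;
it is `0` if the weights are unbounded. -/
def shift (u : ℕ → ℝ) (i : Fin m) : Fock m →L[ℂ] Fock m :=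
  open Classical in
  if h : ∃ C, ∀ k, |u k| ≤ C then
    have key : ∀ g : Fock m, Summable fun α : List (Fin m) =>
        ‖(u α.length : ℂ) * g (i :: α)‖ ^ 2 := fun g => by
      refine ((summable_cons g i).mul_left (h.choose ^ 2)).of_nonneg_of_le
        (fun _ => by positivity) fun α => ?_
      rw [← mul_pow, norm_mul, Complex.norm_real, Real.norm_eq_abs]
      have := h.choose_spec α.length
      gcongr
    LinearMap.mkContinuous
      { toFun := fun g => ⟨fun α => (u α.length : ℂ) * g (i :: α), memℓp_of_summable (key g)⟩
        map_add' := fun g h => by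
          ext α
          exact mul_add _ _ _
        map_smul' := fun c g => by
          ext α
          exact mul_left_comm _ _ _ }
      h.choose fun g => by
        have hC : 0 ≤ h.choose := (abs_nonneg _).trans (h.choose_spec 0)
        refine abs_le_of_sq_le_sq' ?_ (by positivity) |>.2
        refine (hasSum_norm_sq _).tsum_eq.symm.trans_le ?_
        rw [mul_pow]
        calc ∑' α : List (Fin m), ‖(u α.length : ℂ) * g (i :: α)‖ ^ 2
            ≤ ∑' α, h.choose ^ 2 * ‖g (i :: α)‖ ^ 2 := by
              refine (key g).tsum_le_tsum (fun α => ?_) ((summable_cons g i).mul_left _)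
              rw [← mul_pow, norm_mul, Complex.norm_real, Real.norm_eq_abs]
              have := h.choose_spec α.length
              gcongr
          _ = h.choose ^ 2 * ∑' α, ‖g (i :: α)‖ ^ 2 := tsum_mul_left
          _ ≤ h.choose ^ 2 * ‖g‖ ^ 2 := by
              rw [← (hasSum_norm_sq g).tsum_eq]
              exact mul_le_mul_of_nonneg_left (tsum_comp_le_tsum_of_inj
                (hasSum_norm_sq g).summable (fun _ => by positivity)
                (i := fun α => i :: α) List.cons_injective) (by positivity)
  else 0

theorem shift_apply {u : ℕ → ℝ} (h : ∃ C, ∀ k, |u k| ≤ C) (i : Fin m) (g : Fock m)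
    (α : List (Fin m)) : shift u i g α = u α.length * g (i :: α) := by
  rw [shift, dif_pos h]
  rfl

/-- The basis vector of a word. -/
def basis (α : List (Fin m)) : Fock m := lp.single 2 α (1 : ℂ)

theorem basis_apply (α β : List (Fin m)) : basis α β = if β = α then 1 else 0 := by
  simp [basis, Pi.single_apply]

theorem inner_basis (α : List (Fin m)) (g : Fock m) : ⟪basis α, g⟫_ℂ = g α := by
  simp [basis, lp.inner_single_left]

theorem norm_basis (α : List (Fin m)) : ‖basis α‖ = 1 := by
  simp [basis]

instance : Nontrivial (Fock m) :=
  ⟨basis [], 0, fun h => by simpa [h] using norm_basis (m := m) []⟩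

theorem shift_basis_cons {u : ℕ → ℝ} (h : ∃ C, ∀ k, |u k| ≤ C) (i j : Fin m)
    (α : List (Fin m)) :
    shift u i (basis (j :: α)) = if i = j then (u α.length : ℂ) • basis α else 0 := by
  ext β
  rw [shift_apply h, basis_apply]
  split_ifs with h1 h2 h2
  · simp only [List.cons.injEq] at h1
    rw [smul_apply, basis_apply, if_pos h1.2, h1.2]
  · simp_all
  · have : β ≠ α := by rintro rfl; simp_all
    rw [smul_apply, basis_apply, if_neg this, mul_zero, mul_zero]
  · simp

theorem shift_basis_nil {u : ℕ → ℝ} (h : ∃ C, ∀ k, |u k| ≤ C) (i : Fin m) :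
    shift u i (basis []) = 0 := by
  ext β
  rw [shift_apply h, basis_apply]
  simp

theorem adjoint_shift_nil {u : ℕ → ℝ} (h : ∃ C, ∀ k, |u k| ≤ C) (i : Fin m) (g : Fock m) :
    ContinuousLinearMap.adjoint (shift u i) g [] = 0 := by
  rw [← inner_basis, ContinuousLinearMap.adjoint_inner_right, shift_basis_nil h, inner_zero_left]

theorem adjoint_shift_cons {u : ℕ → ℝ} (h : ∃ C, ∀ k, |u k| ≤ C) (i j : Fin m) (g : Fock m)
    (α : List (Fin m)) : ContinuousLinearMap.adjoint (shift u i) g (j :: α) =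
      if i = j then (u α.length : ℂ) * g α else 0 := by
  rw [← inner_basis, ContinuousLinearMap.adjoint_inner_right, shift_basis_cons h]
  split_ifs
  · rw [inner_smul_left, inner_basis]; simp
  · simp

/-- A row of unweighted backward shifts is as bounded as its coefficient vector. -/
theorem norm_sum_smul_shift_one_le (l : Cm m) :
    ‖∑ i, l i • shift (m := m) (fun _ => 1) i‖ ≤ ‖l‖ := by
  have h1 : ∃ C, ∀ k : ℕ, |(fun _ => 1 : ℕ → ℝ) k| ≤ C := ⟨1, by simp⟩
  refine ContinuousLinearMap.opNorm_le_bound _ (norm_nonneg _) fun g => ?_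
  refine abs_le_of_sq_le_sq' ?_ (by positivity) |>.2
  -- The words `i :: α` are pairwise distinct, so the `m` shifted families together have mass at
  -- most `‖g‖ ^ 2`; with Cauchy–Schwarz at each `α`, no factor `m` is lost.
  have hs : Summable fun p : Fin m × List (Fin m) => ‖g (p.1 :: p.2)‖ ^ 2 :=
    (hasSum_norm_sq g).summable.comp_injective (i := fun p : Fin m × List (Fin m) => p.1 :: p.2)
      (by rintro ⟨a, b⟩ ⟨c, d⟩ h; simpa using h)
  have hsα : Summable fun α => ∑ i, ‖g (i :: α)‖ ^ 2 := summable_sum fun i _ => summable_cons g i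
  have hp : ∀ α, ‖(∑ i, l i • shift (m := m) (fun _ => 1) i) g α‖ ^ 2 ≤
      ‖l‖ ^ 2 * ∑ i, ‖g (i :: α)‖ ^ 2 := fun α => by
    have e : (∑ i, l i • shift (m := m) (fun _ => 1) i) g α = ∑ i, l i * g (i :: α) := by
      rw [_root_.sum_apply, coe_sum_apply]
      refine Finset.sum_congr rfl fun i _ => ?_
      rw [_root_.smul_apply, smul_apply, shift_apply h1, Complex.ofReal_one, one_mul]
    rw [e, EuclideanSpace.norm_sq_eq]
    calc _ ≤ (∑ i, ‖l i‖ * ‖g (i :: α)‖) ^ 2 := by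
          gcongr
          exact (norm_sum_le _ _).trans_eq (by simp)
      _ ≤ _ := Finset.sum_mul_sq_le_sq_mul_sq _ _ _
  rw [mul_pow, ← (hasSum_norm_sq _).tsum_eq]
  calc _ ≤ ∑' α, ‖l‖ ^ 2 * ∑ i, ‖g (i :: α)‖ ^ 2 :=
        (hasSum_norm_sq _).summable.tsum_le_tsum hp (hsα.mul_left _)
    _ = ‖l‖ ^ 2 * ∑' α, ∑ i, ‖g (i :: α)‖ ^ 2 := tsum_mul_left
    _ ≤ ‖l‖ ^ 2 * ‖g‖ ^ 2 := by
        gcongr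
        rw [← (hasSum_norm_sq g).tsum_eq]
        calc _ = ∑' p : Fin m × List (Fin m), ‖g (p.1 :: p.2)‖ ^ 2 := by
              rw [Summable.tsum_finsetSum fun i _ => summable_cons g i, hs.tsum_prod, tsum_fintype]
          _ ≤ _ := tsum_comp_le_tsum_of_inj (hasSum_norm_sq g).summable
              (fun _ => by positivity) (i := fun p : Fin m × List (Fin m) => p.1 :: p.2)
              (by rintro ⟨a, b⟩ ⟨c, d⟩ h; simpa using h)

end Fock

/-! ### Power series as sums over words -/

/-- The monomial of a word. -/
def wordProd {R : Type*} [CommMonoid R] (x : Fin m → R) (α : List (Fin m)) : R := (α.map x).prod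

@[simp] theorem wordProd_nil {R : Type*} [CommMonoid R] (x : Fin m → R) : wordProd x [] = 1 := rfl

@[simp] theorem wordProd_cons {R : Type*} [CommMonoid R] (x : Fin m → R) (i : Fin m)
    (α : List (Fin m)) : wordProd x (i :: α) = x i * wordProd x α := by
  simp [wordProd]

theorem wordProd_mul {R : Type*} [CommMonoid R] (x y : Fin m → R) (α : List (Fin m)) :
    wordProd (fun i => x i * y i) α = wordProd x α * wordProd y α := by
  simp [wordProd]

theorem norm_wordProd (x : Fin m → ℂ) (α : List (Fin m)) :
    ‖wordProd x α‖ = wordProd (fun i => ‖x i‖) α := by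
  induction α with
  | nil => simp
  | cons i α ih => simp [ih]

theorem conj_wordProd (x : Fin m → ℂ) (α : List (Fin m)) :
    conj (wordProd x α) = wordProd (fun i => conj (x i)) α := by
  induction α with
  | nil => simp
  | cons i α ih => simp [ih]

/-- Summing over words instead of multi-indices absorbs the multinomial coefficients, so Fock space
weights need only depend on the length. -/
theorem sum_wordProd_ofFn {R : Type*} [CommSemiring R] (x : Fin m → R) (k : ℕ) :
    ∑ f : Fin k → Fin m, wordProd x (List.ofFn f) = (∑ i, x i) ^ k := by
  rw [Fintype.sum_pow]
  refine Finset.sum_congr rfl fun f _ => ?_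
  rw [wordProd, List.map_ofFn, List.prod_ofFn]
  rfl

theorem summable_wordProd_of_nonneg {b : ℕ → ℝ} {x : Fin m → ℝ} (hb : ∀ k, 0 ≤ b k)
    (hx : ∀ i, 0 ≤ x i) (h : Summable fun k => b k * (∑ i, x i) ^ k) :
    Summable fun α : List (Fin m) => b α.length * wordProd x α := by
  rw [← List.equivSigmaTuple.symm.summable_iff]
  have e : ((fun α : List (Fin m) => b α.length * wordProd x α) ∘ List.equivSigmaTuple.symm) =
      fun p : (Σ n, Fin n → Fin m) => b p.1 * wordProd x (List.ofFn p.2) := by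
    funext p
    simp [List.equivSigmaTuple]
  rw [e, summable_sigma_of_nonneg]
  · refine ⟨fun k => Summable.of_finite, ?_⟩
    refine h.congr fun k => ?_
    rw [tsum_fintype, ← sum_wordProd_ofFn, Finset.mul_sum]
  · intro p
    refine mul_nonneg (hb _) (List.prod_nonneg fun y hy => ?_)
    obtain ⟨i, -, rfl⟩ := List.mem_map.1 hy
    exact hx i

theorem hasSum_wordProd {b : ℕ → ℝ} {x : Fin m → ℂ} (hb : ∀ k, 0 ≤ b k)
    (h : Summable fun k => b k * (∑ i, ‖x i‖) ^ k) :
    HasSum (fun α : List (Fin m) => (b α.length : ℂ) * wordProd x α)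
      (∑' k, (b k : ℂ) * (∑ i, x i) ^ k) := by
  have hs : Summable fun α : List (Fin m) => (b α.length : ℂ) * wordProd x α := by
    refine Summable.of_norm ((summable_wordProd_of_nonneg hb (fun i => norm_nonneg (x i)) h).congr
      fun α => ?_)
    rw [norm_mul, norm_wordProd, Complex.norm_real, Real.norm_of_nonneg (hb _)]
  rw [← List.equivSigmaTuple.symm.summable_iff] at hs
  rw [← List.equivSigmaTuple.symm.hasSum_iff]
  have e : ((fun α : List (Fin m) => (b α.length : ℂ) * wordProd x α) ∘
      List.equivSigmaTuple.symm) =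
      fun p : (Σ n, Fin n → Fin m) => (b p.1 : ℂ) * wordProd x (List.ofFn p.2) := by
    funext p
    simp [List.equivSigmaTuple]
  rw [e] at hs ⊢
  convert hs.hasSum using 1
  rw [hs.tsum_sigma]
  refine tsum_congr fun k => ?_
  rw [tsum_fintype, ← sum_wordProd_ofFn, Finset.mul_sum]

end Fock

/-! ### Radial weights and their shifts on the Fock space -/

namespace RadialWeight

open Fock

/-- The growth conditions on a radial weight under which the adjoint of the coordinate tuple lies
in the Cowen–Douglas class of the ball. -/
structure Regular (a : RadialWeight) : Prop where
  down : ∃ C, ∀ k, a.coeff k ≤ C * a.coeff (k + 1)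
  -- The case `l = 1` bounds `raise`; the decay of `A l * t ^ l` keeps the spectral radius of `∑ w i
  -- • raise i` below one on the ball.
  up : ∃ A : ℕ → ℝ, (∀ k l, a.coeff (k + l) ≤ A l * a.coeff k) ∧
    ∀ t : ℝ, 0 ≤ t → t < 1 → Filter.Tendsto (fun l => A l * t ^ l) Filter.atTop (nhds 0)

variable {m : ℕ} (a : RadialWeight)

theorem sum_norm_mul_conj_lt_one (z w : unitBall m) :
    ∑ i, ‖(z : Cm m) i * conj ((w : Cm m) i)‖ < 1 := by
  have hz : ‖(z : Cm m)‖ < 1 := by simpa [unitBall] using z.2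
  have hw : ‖(w : Cm m)‖ < 1 := by simpa [unitBall] using w.2
  have h : (∑ i, ‖(z : Cm m) i * conj ((w : Cm m) i)‖) ^ 2 ≤
      ‖(z : Cm m)‖ ^ 2 * ‖(w : Cm m)‖ ^ 2 := by
    rw [EuclideanSpace.norm_sq_eq, EuclideanSpace.norm_sq_eq]
    simp only [norm_mul, RCLike.norm_conj]
    exact Finset.sum_mul_sq_le_sq_mul_sq _ _ _
  have h2 : ∑ i, ‖(z : Cm m) i * conj ((w : Cm m) i)‖ ≤ ‖(z : Cm m)‖ * ‖(w : Cm m)‖ := by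
    refine abs_le_of_sq_le_sq' ?_ (by positivity) |>.2
    rw [mul_pow]
    exact h
  nlinarith [norm_nonneg (z : Cm m), norm_nonneg (w : Cm m)]

theorem inner_eq_sum (z w : Cm m) : ⟪w, z⟫_ℂ = ∑ i, z i * conj (w i) := by
  simp [PiLp.inner_apply]

theorem hasSum_kernel (z w : unitBall m) :
    HasSum (fun α : List (Fin m) => (a.coeff α.length : ℂ) *
      wordProd (fun i => (z : Cm m) i * conj ((w : Cm m) i)) α) (a.kernel m z w) := by
  have h := hasSum_wordProd (b := a.coeff)
    (x := fun i => (z : Cm m) i * conj ((w : Cm m) i)) (fun k => (a.pos k).le)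
    (a.summable _ (Finset.sum_nonneg fun i _ => norm_nonneg _) (sum_norm_mul_conj_lt_one z w))
  simpa only [kernel, Matrix.of_apply, inner_eq_sum] using h

/-- The feature vector of a point, whose Gram matrix is the kernel. -/
def feature (z : unitBall m) : Fock m :=
  ⟨fun α => (√(a.coeff α.length) : ℂ) * conj (wordProd (z : Cm m) α), memℓp_of_summable (by
    have h := (a.hasSum_kernel z z).summable.norm
    refine h.congr fun α => ?_
    rw [wordProd_mul, ← conj_wordProd]
    simp only [norm_mul, RCLike.norm_conj, Complex.norm_real, Real.norm_eq_abs, mul_pow, sq_abs]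
    rw [Real.sq_sqrt (a.pos _).le, abs_of_pos (a.pos _)]
    ring)⟩

theorem feature_apply (z : unitBall m) (α : List (Fin m)) :
    a.feature z α = (√(a.coeff α.length) : ℂ) * conj (wordProd (z : Cm m) α) := rfl

theorem inner_feature (z w : unitBall m) : ⟪a.feature z, a.feature w⟫_ℂ = a.kernel m z w := by
  rw [← (a.hasSum_kernel z w).tsum_eq, lp.inner_eq_tsum]
  refine tsum_congr fun α => ?_
  rw [wordProd_mul, ← conj_wordProd, RCLike.inner_apply, feature_apply, feature_apply]
  have h : (√(a.coeff α.length) : ℂ) * (√(a.coeff α.length) : ℂ) = a.coeff α.length := by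
    rw [← Complex.ofReal_mul, Real.mul_self_sqrt (a.pos _).le]
  rw [map_mul, Complex.conj_conj, Complex.conj_ofReal, ← h]
  ring

/-- The adjoint of the multiplication by the `i`-th coordinate, on the Fock space. -/
def lower (i : Fin m) : Fock m →L[ℂ] Fock m := shift (fun k => √(a.coeff k / a.coeff (k + 1))) i

/-- The creation operator which is right inverse to `lower`. -/
def raise (i : Fin m) : Fock m →L[ℂ] Fock m :=
  ContinuousLinearMap.adjoint (shift (fun k => √(a.coeff (k + 1) / a.coeff k)) i)

variable {a}

theorem Regular.lower_bdd (ha : a.Regular) : ∃ C, ∀ k, |√(a.coeff k / a.coeff (k + 1))| ≤ C := by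
  obtain ⟨C, hC⟩ := ha.down
  refine ⟨√C, fun k => ?_⟩
  rw [abs_of_nonneg (Real.sqrt_nonneg _)]
  exact Real.sqrt_le_sqrt ((div_le_iff₀ (a.pos _)).2 (hC k))

theorem Regular.raise_bdd (ha : a.Regular) : ∃ C, ∀ k, |√(a.coeff (k + 1) / a.coeff k)| ≤ C := by
  obtain ⟨A, hA, -⟩ := ha.up
  refine ⟨√(A 1), fun k => ?_⟩
  rw [abs_of_nonneg (Real.sqrt_nonneg _)]
  exact Real.sqrt_le_sqrt ((div_le_iff₀ (a.pos _)).2 (hA k 1))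

theorem Regular.lower_apply (ha : a.Regular) (i : Fin m) (g : Fock m) (α : List (Fin m)) :
    a.lower i g α = √(a.coeff α.length / a.coeff (α.length + 1)) * g (i :: α) :=
  shift_apply ha.lower_bdd _ _ _

theorem Regular.raise_nil (ha : a.Regular) (i : Fin m) (g : Fock m) : a.raise i g [] = 0 :=
  adjoint_shift_nil ha.raise_bdd _ _

theorem Regular.raise_cons (ha : a.Regular) (i j : Fin m) (g : Fock m) (α : List (Fin m)) :
    a.raise i g (j :: α) =
      if i = j then (√(a.coeff (α.length + 1) / a.coeff α.length) : ℂ) * g α else 0 :=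
  adjoint_shift_cons ha.raise_bdd _ _ _ _

theorem Regular.lower_feature (ha : a.Regular) (i : Fin m) (z : unitBall m) :
    a.lower i (a.feature z) = conj ((z : Cm m) i) • a.feature z := by
  ext α
  rw [ha.lower_apply, smul_apply, feature_apply, feature_apply, wordProd_cons, List.length_cons,
    Real.sqrt_div (a.pos _).le, map_mul]
  have : (√(a.coeff (α.length + 1)) : ℂ) ≠ 0 := by
    exact_mod_cast (Real.sqrt_pos.2 (a.pos _)).ne'
  push_cast
  field_simp

/-- Deleting the first letter and restoring it loses only the empty word, since the weights of
`raise` and `lower` are reciprocal. -/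
theorem Regular.sum_raise_lower (ha : a.Regular) (g : Fock m) :
    ∑ i, a.raise i (a.lower i g) = g - g [] • basis [] := by
  ext α
  rw [coe_sum_apply, lp.coeFn_sub, Pi.sub_apply, smul_apply, basis_apply]
  cases α with
  | nil => simp [ha.raise_nil]
  | cons j α =>
    simp only [ha.raise_cons, Finset.sum_ite_eq', Finset.mem_univ, if_true, ha.lower_apply]
    have h : √(a.coeff (α.length + 1) / a.coeff α.length) *
        √(a.coeff α.length / a.coeff (α.length + 1)) = 1 := by
      have h1 := a.pos α.length
      have h2 := a.pos (α.length + 1)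
      rw [← Real.sqrt_mul (by positivity), div_mul_div_cancel₀ h1.ne', div_self h2.ne',
        Real.sqrt_one]
    rw [← mul_assoc, ← Complex.ofReal_mul, h]
    simp

/-- Read as `(1 - ∑ z̄ᵢ raise i) (feature z) = √a(0) • basis []`, this expresses the feature vector
through the resolvent. -/
theorem Regular.sum_smul_raise_feature (ha : a.Regular) (z : unitBall m) :
    ∑ i, conj ((z : Cm m) i) • a.raise i (a.feature z) =
      a.feature z - (√(a.coeff 0) : ℂ) • basis [] := by
  ext α
  rw [coe_sum_apply, lp.coeFn_sub, Pi.sub_apply, smul_apply, basis_apply]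
  cases α with
  | nil => simp [smul_apply, ha.raise_nil, feature_apply, -RCLike.star_def]
  | cons j α =>
    simp only [smul_apply, ha.raise_cons, mul_ite, mul_zero, Finset.sum_ite_eq', Finset.mem_univ,
      if_true, feature_apply, wordProd_cons, List.length_cons, map_mul]
    rw [Real.sqrt_div (a.pos _).le]
    have : (√(a.coeff α.length) : ℂ) ≠ 0 := by
      exact_mod_cast (Real.sqrt_pos.2 (a.pos _)).ne'
    simp
    field_simp

/-- The weighted row shift `∑ i, l i • shift i` has powers dominated by those of the unweighted
one. -/
theorem Regular.norm_row_pow_le (ha : a.Regular)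
    {A : ℕ → ℝ} (hA : ∀ k l, a.coeff (k + l) ≤ A l * a.coeff k)
    (x : Cm m) (l : ℕ) :
    ‖(∑ i, x i • shift (m := m) (fun k => √(a.coeff (k + 1) / a.coeff k)) i) ^ l‖ ≤
      √(A l) * ‖x‖ ^ l := by
  set D := ∑ i, x i • shift (m := m) (fun k => √(a.coeff (k + 1) / a.coeff k)) i with hD
  set U := ∑ i, x i • shift (m := m) (fun _ => 1) i with hU
  have h1 : ∃ C, ∀ k : ℕ, |(fun _ => 1 : ℕ → ℝ) k| ≤ C := ⟨1, by simp⟩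
  have hDa : ∀ g α, D g α = (√(a.coeff (α.length + 1) / a.coeff α.length) : ℂ) *
      ∑ i, x i * g (i :: α) := fun g α => by
    rw [hD, _root_.sum_apply, coe_sum_apply, Finset.mul_sum]
    refine Finset.sum_congr rfl fun i _ => ?_
    rw [_root_.smul_apply, smul_apply, shift_apply ha.raise_bdd]
    ring
  have hUa : ∀ g α, U g α = ∑ i, x i * g (i :: α) := fun g α => by
    rw [hU, _root_.sum_apply, coe_sum_apply]
    refine Finset.sum_congr rfl fun i _ => ?_
    rw [_root_.smul_apply, smul_apply, shift_apply h1]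
    simp
  -- The weights telescope along a power, leaving a single quotient of coefficients at distance `l`.
  have hpow : ∀ l g α, (D ^ l) g α =
      (√(a.coeff (α.length + l) / a.coeff α.length) : ℂ) * (U ^ l) g α := by
    intro l
    induction l with
    | zero => intro g α; simp [div_self (a.pos _).ne']
    | succ l ih =>
      intro g α
      rw [pow_succ' D, pow_succ' U, mul_apply_eq_comp, mul_apply_eq_comp,
        hDa, hUa, Finset.mul_sum, Finset.mul_sum]
      refine Finset.sum_congr rfl fun i _ => ?_
      rw [ih, List.length_cons]
      have h : √(a.coeff (α.length + 1) / a.coeff α.length) *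
          √(a.coeff (α.length + 1 + l) / a.coeff (α.length + 1)) =
          √(a.coeff (α.length + (l + 1)) / a.coeff α.length) := by
        have h1 := a.pos α.length
        have h2 := a.pos (α.length + 1)
        rw [← Real.sqrt_mul (by positivity), mul_comm, div_mul_div_cancel₀ h2.ne',
          show α.length + 1 + l = α.length + (l + 1) by ring]
      rw [← h]
      push_cast
      ring
  refine ContinuousLinearMap.opNorm_le_bound _ (by positivity) fun g => ?_
  calc ‖(D ^ l) g‖ ≤ √(A l) * ‖(U ^ l) g‖ := by
        refine norm_le_of_forall_norm_le (Real.sqrt_nonneg _) fun α => ?_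
        rw [hpow, norm_mul, Complex.norm_real, Real.norm_of_nonneg (Real.sqrt_nonneg _)]
        gcongr
        exact (div_le_iff₀ (a.pos _)).2 (hA _ _)
    _ ≤ √(A l) * (‖x‖ ^ l * ‖g‖) := by
        gcongr
        refine ((U ^ l).le_opNorm g).trans ?_
        gcongr
        refine (norm_pow_le U l).trans ?_
        gcongr
        exact norm_sum_smul_shift_one_le x
    _ = _ := by ring

theorem Regular.isUnit_one_sub_row (ha : a.Regular) {x : Cm m} (hx : ‖x‖ < 1) :
    IsUnit (1 - ∑ i, x i • shift (m := m) (fun k => √(a.coeff (k + 1) / a.coeff k)) i) := by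
  obtain ⟨A, hA, hlim⟩ := ha.up
  set D := ∑ i, x i • shift (m := m) (fun k => √(a.coeff (k + 1) / a.coeff k)) i with hD
  obtain ⟨l, hl⟩ : ∃ l, ‖D ^ l‖ < 1 := by
    -- The norm bound contains `√(A l)`, so the decay is needed at `t = ‖x‖ ^ 2`.
    have h := hlim (‖x‖ ^ 2) (by positivity) (pow_lt_one₀ (norm_nonneg _) hx two_ne_zero)
    obtain ⟨l, hl⟩ := (h.eventually (gt_mem_nhds one_pos)).exists
    refine ⟨l, (ha.norm_row_pow_le hA x l).trans_lt ?_⟩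
    rw [← pow_mul, mul_comm 2 l, pow_mul] at hl
    calc √(A l) * ‖x‖ ^ l = √(A l * (‖x‖ ^ l) ^ 2) := by
          rw [Real.sqrt_mul' _ (by positivity), Real.sqrt_sq (by positivity)]
      _ < 1 := by rwa [Real.sqrt_lt' one_pos, one_pow]
  -- One contractive power suffices: `1 - D` is a commuting factor of `1 - D ^ l`.
  have hu : IsUnit (1 - D ^ l) := isUnit_one_sub_of_norm_lt_one hl
  rw [← mul_neg_geom_sum] at hu
  refine ((Commute.isUnit_mul_iff ?_).1 hu).1
  exact (mul_neg_geom_sum D l).trans (geom_sum_mul_neg D l).symm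

theorem Regular.isUnit_one_sub_raise (ha : a.Regular) {w : Cm m} (hw : ‖w‖ < 1) :
    IsUnit (1 - ∑ i, w i • (a.raise i : Fock m →L[ℂ] Fock m)) := by
  have h := (ha.isUnit_one_sub_row (x := WithLp.toLp 2 fun i => conj (w i)) (by
    rw [EuclideanSpace.norm_eq] at hw ⊢
    simpa using hw)).star
  convert h using 1
  simp [raise, star_sum, ContinuousLinearMap.star_eq_adjoint]

end RadialWeight

/-! ### Joint kernels and similarity -/

section Tuples

variable {m : ℕ} {H : Type*} [NormedAddCommGroup H] [InnerProductSpace ℂ H]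

theorem mem_jointKer {T : Fin m → H →L[ℂ] H} {w : Cm m} {x : H} :
    x ∈ jointKer T w ↔ ∀ i, T i x = w i • x := by
  simp [jointKer, Submodule.mem_iInf, sub_eq_zero]

theorem IsSimilar.symm {H' : Type*} [NormedAddCommGroup H'] [InnerProductSpace ℂ H']
    {T : Fin m → H →L[ℂ] H} {S : Fin m → H' →L[ℂ] H'} (h : IsSimilar T S) : IsSimilar S T := by
  obtain ⟨X, hX⟩ := h
  refine ⟨X.symm, fun i x => ?_⟩
  apply X.injective
  rw [hX, X.apply_symm_apply, X.apply_symm_apply]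

end Tuples

/-! ### The space with a radial reproducing kernel inside the Fock space -/

section KernelSpace

open ContinuousLinearMap (adjoint)
open Fock

variable {m : ℕ} (H : Type*) [NormedAddCommGroup H] [InnerProductSpace ℂ H] [CompleteSpace H]
  [RKHS ℂ H (unitBall m) ℂ]

/-- The kernel function of a point. -/
def kerVec (z : unitBall m) : H := RKHS.kerFun H z (1 : ℂ)

variable {H} in
theorem inner_kerVec (z : unitBall m) (f : H) : ⟪kerVec H z, f⟫_ℂ = f z := by
  rw [kerVec, RKHS.kerFun_inner]
  simp

theorem topologicalClosure_span_kerVec :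
    (Submodule.span ℂ (Set.range (kerVec H : unitBall m → H))).topologicalClosure = ⊤ := by
  rw [eq_top_iff, ← RKHS.kerFun_dense H]
  refine Submodule.topologicalClosure_mono (Submodule.span_le.2 ?_)
  rintro _ ⟨z, v, rfl⟩
  have : RKHS.kerFun H z v = v • kerVec H z := by
    rw [kerVec, ← map_smul, smul_eq_mul, mul_one]
  rw [this]
  exact Submodule.smul_mem _ _ (Submodule.subset_span ⟨z, rfl⟩)

theorem denseRange_linearCombination_kerVec :
    DenseRange (Finsupp.linearCombination ℂ (kerVec H : unitBall m → H)) := by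
  have h := topologicalClosure_span_kerVec (m := m) H
  rw [← Finsupp.range_linearCombination, ← Submodule.dense_iff_topologicalClosure_eq_top] at h
  exact h

variable {H} in
/-- Two bounded operators agree if they agree at the kernel functions. -/
theorem clm_ext_kerVec {G : Type*} [NormedAddCommGroup G] [InnerProductSpace ℂ G]
    {A B : H →L[ℂ] G} (h : ∀ z : unitBall m, A (kerVec H z) = B (kerVec H z)) : A = B := by
  refine ContinuousLinearMap.ext fun x => ?_
  refine (denseRange_linearCombination_kerVec (m := m) H).induction_on x
    (isClosed_eq A.continuous B.continuous) fun c => ?_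
  simp [Finsupp.linearCombination_apply, Finsupp.sum, h]

variable {H} in
theorem inner_kerVec_kerVec {k : Matrix (unitBall m) (unitBall m) ℂ}
    (hK : RKHS.kernel H = scalarKernel k) (z w : unitBall m) :
    ⟪kerVec H z, kerVec H w⟫_ℂ = k z w := by
  rw [inner_kerVec, kerVec, RKHS.kerFun_apply, hK]
  simp [scalarKernel]

/-- The embedding into the Fock space which maps kernel functions to feature vectors. -/
def RadialWeight.embed (a : RadialWeight) : H →L[ℂ] Fock m :=
  (Finsupp.linearCombination ℂ (a.feature (m := m))).extendOfNorm
    (Finsupp.linearCombination ℂ (kerVec H))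

variable {H} {a : RadialWeight}

/-- Kernel functions and feature vectors have the same Gram matrix; this is what makes `embed` a
well-defined isometry. -/
theorem norm_linearCombination_feature (hK : RKHS.kernel H = scalarKernel (a.kernel m))
    (c : unitBall m →₀ ℂ) :
    ‖Finsupp.linearCombination ℂ (a.feature (m := m)) c‖ =
      ‖Finsupp.linearCombination ℂ (kerVec H) c‖ := by
  have h : ⟪Finsupp.linearCombination ℂ (a.feature (m := m)) c,
      Finsupp.linearCombination ℂ (a.feature (m := m)) c⟫_ℂ =
      ⟪Finsupp.linearCombination ℂ (kerVec H) c, Finsupp.linearCombination ℂ (kerVec H) c⟫_ℂ := by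
    simp only [Finsupp.linearCombination_apply, Finsupp.sum_inner, Finsupp.inner_sum,
      inner_smul_left, inner_smul_right, a.inner_feature, inner_kerVec_kerVec hK]
  rw [inner_self_eq_norm_sq_to_K, inner_self_eq_norm_sq_to_K] at h
  have h' : ‖Finsupp.linearCombination ℂ (a.feature (m := m)) c‖ ^ 2 =
      ‖Finsupp.linearCombination ℂ (kerVec H) c‖ ^ 2 := by exact_mod_cast h
  exact (sq_eq_sq₀ (norm_nonneg _) (norm_nonneg _)).1 h'

theorem embed_linearCombination (hK : RKHS.kernel H = scalarKernel (a.kernel m))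
    (c : unitBall m →₀ ℂ) :
    a.embed H (Finsupp.linearCombination ℂ (kerVec H) c) =
      Finsupp.linearCombination ℂ (a.feature (m := m)) c :=
  LinearMap.extendOfNorm_eq (denseRange_linearCombination_kerVec H)
    ⟨1, fun c => by rw [one_mul, norm_linearCombination_feature hK]⟩ c

theorem embed_kerVec (hK : RKHS.kernel H = scalarKernel (a.kernel m))
    (z : unitBall m) : a.embed H (kerVec H z) = a.feature z := by
  simpa using embed_linearCombination hK (Finsupp.single z 1)

theorem norm_embed (hK : RKHS.kernel H = scalarKernel (a.kernel m))
    (x : H) : ‖a.embed H x‖ = ‖x‖ := by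
  refine (denseRange_linearCombination_kerVec (m := m) H).induction_on x
    (isClosed_eq (by fun_prop) (by fun_prop)) fun c => ?_
  rw [embed_linearCombination hK, norm_linearCombination_feature hK]

theorem adjoint_embed_embed (hK : RKHS.kernel H = scalarKernel (a.kernel m))
    (x : H) : adjoint (a.embed H) (a.embed H x) = x := by
  have h := (ContinuousLinearMap.norm_map_iff_adjoint_comp_self (a.embed H)).1 (norm_embed hK)
  simpa using congrArg (fun A : H →L[ℂ] H => A x) h

theorem adjoint_embed_feature (hK : RKHS.kernel H = scalarKernel (a.kernel m)) (z : unitBall m) :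
    adjoint (a.embed H) (a.feature z) = kerVec H z := by
  rw [← embed_kerVec hK, adjoint_embed_embed hK]

variable (a H) in
/-- The adjoint of the multiplication by the `i`-th coordinate. -/
def RadialWeight.backward (i : Fin m) : H →L[ℂ] H :=
  adjoint (a.embed H) ∘L a.lower i ∘L a.embed H

theorem backward_kerVec (hK : RKHS.kernel H = scalarKernel (a.kernel m)) (ha : a.Regular)
    (i : Fin m) (z : unitBall m) :
    a.backward H i (kerVec H z) = conj ((z : Cm m) i) • kerVec H z := by
  simp [RadialWeight.backward, embed_kerVec hK, ha.lower_feature, adjoint_embed_feature hK,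
    -RCLike.star_def]

/-- The range of `embed` is invariant under `lower`, because feature vectors are eigenvectors, so
the compression in `backward` is a restriction. -/
theorem embed_backward (hK : RKHS.kernel H = scalarKernel (a.kernel m)) (ha : a.Regular)
    (i : Fin m) (x : H) :
    a.embed H (a.backward H i x) = a.lower i (a.embed H x) := by
  have h : a.embed H ∘L a.backward H i = a.lower i ∘L a.embed H := by
    refine clm_ext_kerVec fun z => ?_
    simp [backward_kerVec hK ha, embed_kerVec hK, ha.lower_feature]
  exact congrArg (fun A : H →L[ℂ] Fock m => A x) h

theorem isCoordinateMultiplication_adjoint_backward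
    (hK : RKHS.kernel H = scalarKernel (a.kernel m)) (ha : a.Regular) :
    IsCoordinateMultiplication fun i => adjoint (a.backward H i) := by
  intro i f z
  rw [← inner_kerVec, ContinuousLinearMap.adjoint_inner_right, backward_kerVec hK ha,
    inner_smul_left, Complex.conj_conj, inner_kerVec]

theorem adjointTuple_adjoint_backward :
    adjointTuple (fun i => adjoint (a.backward H i)) = a.backward H := by
  funext i
  simp [adjointTuple]

/-! ### Membership in the Cowen–Douglas class -/

variable (m) in
/-- Coordinatewise conjugation. -/
def conjPt (w : Cm m) : Cm m := WithLp.toLp 2 fun i => conj (w i)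

theorem norm_conjPt (w : Cm m) : ‖conjPt m w‖ = ‖w‖ := by
  simp [EuclideanSpace.norm_eq, conjPt]

theorem conjPt_mem {w : Cm m} (hw : w ∈ unitBall m) : conjPt m w ∈ unitBall m := by
  simpa [unitBall, norm_conjPt] using hw

/-- The conjugate of a point of the ball, as a point of the ball. -/
def conjBall (w : unitBall m) : unitBall m := ⟨conjPt m w, conjPt_mem w.2⟩

theorem conj_conjBall (w : unitBall m) (i : Fin m) :
    conj ((conjBall w : Cm m) i) = (w : Cm m) i := by
  simp [conjBall, conjPt]

theorem kerVec_mem_jointKer (hK : RKHS.kernel H = scalarKernel (a.kernel m)) (ha : a.Regular)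
    (w : unitBall m) :
    kerVec H (conjBall w) ∈ jointKer (a.backward H) w := by
  rw [mem_jointKer]
  intro i
  rw [backward_kerVec hK ha, conj_conjBall]

variable (a) in
/-- The resolvent of the creation operators. -/
def RadialWeight.resolvent (w : Cm m) : Fock m →L[ℂ] Fock m :=
  Ring.inverse (1 - ∑ i, w i • (a.raise i : Fock m →L[ℂ] Fock m))

theorem resolvent_apply_sub (ha : a.Regular) {w : Cm m} (hw : w ∈ unitBall m) (g : Fock m) :
    a.resolvent w (g - ∑ i, w i • a.raise i g) = g := by
  have hw' : ‖w‖ < 1 := by simpa [unitBall] using hw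
  have h := Ring.inverse_mul_cancel _ (ha.isUnit_one_sub_raise hw')
  have h' := congrArg (fun A : Fock m →L[ℂ] Fock m => A g) h
  simpa [RadialWeight.resolvent, _root_.sum_apply] using h'

theorem resolvent_basis_nil (ha : a.Regular) (w : unitBall m) :
    (√(a.coeff 0) : ℂ) • a.resolvent (w : Cm m) (basis []) = a.feature (conjBall w) := by
  have h := resolvent_apply_sub ha w.2 (a.feature (conjBall w))
  have h2 := ha.sum_smul_raise_feature (conjBall w)
  simp only [conj_conjBall] at h2
  rw [h2, sub_sub_cancel, map_smul] at h
  exact h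

variable (a H) in
/-- A regularizer of `T - w`, that is, a left inverse of this operator modulo rank one. -/
def RadialWeight.regularizer (w : Cm m) (i : Fin m) : H →L[ℂ] H :=
  adjoint (a.embed H) ∘L a.resolvent w ∘L a.raise i ∘L a.embed H

/-- By `sum_raise_lower`, `∑ raise i ∘ (lower i - w i)` is `1 - ∑ w i • raise i` minus a rank one
term along `basis []`. The resolvent turns the first part into the identity and `basis []` into a
multiple of the feature vector. -/
theorem sum_regularizer (hK : RKHS.kernel H = scalarKernel (a.kernel m)) (ha : a.Regular)
    (w : unitBall m) (x : H) :
    ∑ i, a.regularizer H w i (a.backward H i x - (w : Cm m) i • x) =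
      x - (a.embed H x [] / (√(a.coeff 0) : ℂ)) • kerVec H (conjBall w) := by
  have h0 : (√(a.coeff 0) : ℂ) ≠ 0 := by exact_mod_cast (Real.sqrt_pos.2 (a.pos 0)).ne'
  have h1 : ∀ i, a.regularizer H w i (a.backward H i x - (w : Cm m) i • x) =
      adjoint (a.embed H) (a.resolvent w (a.raise i (a.lower i (a.embed H x)) -
        (w : Cm m) i • a.raise i (a.embed H x))) := fun i => by
    simp only [RadialWeight.regularizer, ContinuousLinearMap.comp_apply, map_sub, map_smul,
      embed_backward hK ha]
  simp only [h1]
  rw [← map_sum, ← map_sum, Finset.sum_sub_distrib, ha.sum_raise_lower, sub_right_comm, map_sub,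
    resolvent_apply_sub ha w.2, map_sub, adjoint_embed_embed hK, map_smul, map_smul,
    ← adjoint_embed_feature hK, ← resolvent_basis_nil ha, map_smul, smul_smul,
    div_mul_cancel₀ _ h0]

theorem jointKer_eq_span (hK : RKHS.kernel H = scalarKernel (a.kernel m)) (ha : a.Regular)
    (w : unitBall m) :
    jointKer (a.backward H) w = Submodule.span ℂ {kerVec H (conjBall w)} := by
  refine le_antisymm (fun x hx => ?_) ?_
  · rw [mem_jointKer] at hx
    have h := sum_regularizer hK ha w x
    simp only [hx, sub_self, map_zero, Finset.sum_const_zero] at h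
    rw [eq_comm, sub_eq_zero] at h
    rw [h]
    exact Submodule.smul_mem _ _ (Submodule.mem_span_singleton_self _)
  · rw [Submodule.span_singleton_le_iff_mem]
    exact kerVec_mem_jointKer hK ha w

theorem norm_kerVec_sq (hK : RKHS.kernel H = scalarKernel (a.kernel m)) (z : unitBall m) :
    (‖kerVec H z‖ ^ 2 : ℝ) = ∑' i, a.coeff i * (‖(z : Cm m)‖ ^ 2) ^ i := by
  have h := inner_kerVec_kerVec hK z z
  rw [inner_self_eq_norm_sq_to_K, RadialWeight.kernel, Matrix.of_apply,
    inner_self_eq_norm_sq_to_K] at h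
  apply Complex.ofReal_injective
  push_cast
  exact h

theorem kerVec_ne_zero (hK : RKHS.kernel H = scalarKernel (a.kernel m))
    (z : unitBall m) : kerVec H z ≠ 0 := by
  intro h
  have h2 := embed_kerVec hK z
  rw [h, map_zero] at h2
  have h3 : a.feature z [] = 0 := by rw [← h2]; rfl
  rw [RadialWeight.feature_apply] at h3
  simp [(Real.sqrt_pos.2 (a.pos 0)).ne'] at h3

theorem isClosed_range_backward (hK : RKHS.kernel H = scalarKernel (a.kernel m)) (ha : a.Regular)
    (w : unitBall m) :
    IsClosed (Set.range fun (x : H) (i : Fin m) => a.backward H i x - (w : Cm m) i • x) := by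
  have hmem := mem_jointKer.1 (kerVec_mem_jointKer hK ha w)
  -- With `R` the sum of the regularizers, `R (T - w) x` differs from `x` by a joint eigenvector, so
  -- `(T - w) R (T - w) = T - w`. The range is thus the fixed-point set of the continuous map `(T -
  -- w) R`.
  have e : (Set.range fun (x : H) (i : Fin m) => a.backward H i x - (w : Cm m) i • x) =
      {y | ∀ i, a.backward H i (∑ j, a.regularizer H w j (y j)) -
        (w : Cm m) i • (∑ j, a.regularizer H w j (y j)) = y i} := by
    ext y
    constructor
    · rintro ⟨x, rfl⟩ i
      rw [sum_regularizer hK ha, map_sub, map_smul, hmem, smul_sub, smul_comm ((w : Cm m) i)]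
      exact sub_sub_sub_cancel_right _ _ _
    · intro hy
      exact ⟨∑ j, a.regularizer H w j (y j), funext hy⟩
  rw [e]
  simp only [Set.ofPred_forall]
  refine isClosed_iInter fun i => isClosed_eq ?_ (continuous_apply i)
  fun_prop

theorem cowenDouglas_backward (hK : RKHS.kernel H = scalarKernel (a.kernel m)) (ha : a.Regular)
    : CowenDouglas 1 (unitBall m) (a.backward H) where
  comm i j := by
    refine clm_ext_kerVec fun z => ?_
    simp [backward_kerVec hK ha, smul_smul, mul_comm, -RCLike.star_def]
  isClosed_range w hw := isClosed_range_backward hK ha ⟨w, hw⟩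
  dense_span := by
    rw [eq_top_iff, ← topologicalClosure_span_kerVec (m := m) H]
    refine Submodule.topologicalClosure_mono (Submodule.span_le.2 ?_)
    rintro _ ⟨z, rfl⟩
    have h := kerVec_mem_jointKer hK ha (conjBall z)
    have e : conjBall (conjBall z) = z := by
      apply Subtype.ext
      ext i
      simp [conjBall, conjPt]
    rw [e] at h
    exact Submodule.mem_iSup_of_mem _ (Submodule.mem_iSup_of_mem (conjBall z).2 h)
  finrank_jointKer w hw := by
    rw [jointKer_eq_span hK ha ⟨w, hw⟩]
    exact finrank_span_singleton (kerVec_ne_zero hK _)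

/-! ### The holomorphic section -/

variable (a H) in
/-- A holomorphic section of the kernel bundle. -/
def RadialWeight.kernelSection (w : Cm m) : H :=
  (√(a.coeff 0) : ℂ) • adjoint (a.embed H) (a.resolvent w (basis []))

theorem kernelSection_eq (hK : RKHS.kernel H = scalarKernel (a.kernel m)) (ha : a.Regular)
    (w : unitBall m) : a.kernelSection H w = kerVec H (conjBall w) := by
  rw [RadialWeight.kernelSection, ← map_smul, resolvent_basis_nil ha, adjoint_embed_feature hK]

theorem norm_kernelSection_sq (hK : RKHS.kernel H = scalarKernel (a.kernel m)) (ha : a.Regular)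
    {w : Cm m} (hw : w ∈ unitBall m) :
    ‖a.kernelSection H w‖ ^ 2 = ∑' i, a.coeff i * (‖w‖ ^ 2) ^ i := by
  rw [kernelSection_eq hK ha ⟨w, hw⟩, norm_kerVec_sq hK]
  simp [conjBall, norm_conjPt]

/-- Holomorphy is read off the resolvent formula, the other two properties from the equality with
kernel functions on the ball. -/
theorem isNonvanishingSection_kernelSection
    (hK : RKHS.kernel H = scalarKernel (a.kernel m)) (ha : a.Regular) :
    IsNonvanishingSection (a.backward H) (unitBall m) (a.kernelSection H) where
  holomorphic := by
    intro w hw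
    apply DifferentiableAt.differentiableWithinAt
    have hw' : ‖w‖ < 1 := by simpa [unitBall] using hw
    have hu := ha.isUnit_one_sub_raise hw'
    have h1 : DifferentiableAt ℂ (fun w : Cm m =>
        1 - ∑ i, w i • (a.raise i : Fock m →L[ℂ] Fock m)) w := by fun_prop
    have h2 : DifferentiableAt ℂ (a.resolvent (m := m)) w := by
      exact (differentiableAt_inverse (𝕜 := ℂ) hu).comp w h1
    unfold RadialWeight.kernelSection
    exact ((adjoint (a.embed H)).differentiableAt.comp w
      (h2.clm_apply (differentiableAt_const _))).const_smul _
  mem w hw := by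
    rw [kernelSection_eq hK ha ⟨w, hw⟩]
    exact kerVec_mem_jointKer hK ha ⟨w, hw⟩
  ne_zero w hw := by
    rw [kernelSection_eq hK ha ⟨w, hw⟩]
    exact kerVec_ne_zero hK _

end KernelSpace

/-! ### Powers of a coordinate, hypercontractions and similarity -/

section Monomials

open ContinuousLinearMap (adjoint)
open Fock

theorem eq_zero_of_hasSum_zero {b : ℕ → ℂ}
    (h : ∀ ζ : ℂ, ‖ζ‖ < 1 → HasSum (fun k => b k * ζ ^ k) 0) (k : ℕ) : b k = 0 := by
  have h1 : HasFPowerSeriesAt (0 : ℂ → ℂ) (FormalMultilinearSeries.ofScalars ℂ b) 0 := by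
    rw [hasFPowerSeriesAt_iff]
    filter_upwards [Metric.ball_mem_nhds (0 : ℂ) one_pos] with ζ hζ
    have := h ζ (by simpa using hζ)
    simpa [FormalMultilinearSeries.coeff_ofScalars, mul_comm] using this
  have h2 := h1.eq_zero
  rw [← FormalMultilinearSeries.coeff_ofScalars (𝕜 := ℂ) (p := b) (n := k), h2]
  rfl

variable {m : ℕ} {H : Type*} [NormedAddCommGroup H] [InnerProductSpace ℂ H] [CompleteSpace H]
  [RKHS ℂ H (unitBall m) ℂ] {a : RadialWeight}

theorem wordProd_single (i : Fin m) (ζ : ℂ) (α : List (Fin m)) :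
    wordProd (EuclideanSpace.single i ζ : Cm m) α =
      if α = List.replicate α.length i then ζ ^ α.length else 0 := by
  induction α with
  | nil => simp
  | cons j α ih =>
    rw [wordProd_cons, ih, List.length_cons, List.replicate_succ]
    by_cases hj : j = i
    · subst hj
      by_cases h : α = List.replicate α.length j
      · rw [if_pos h, if_pos (by rw [← h]), pow_succ']
        simp
      · rw [if_neg h, if_neg (by simpa using h), mul_zero]
    · rw [if_neg fun h => hj (List.cons.inj h).1]
      simp [hj]

/-- On the `i`-th coordinate axis only the words `i…i` contribute, so pairing with features gives a
one-variable power series to which the identity theorem applies. -/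
theorem apply_replicate_eq_zero {y : Fock m} (hy : ∀ z : unitBall m, ⟪a.feature z, y⟫_ℂ = 0)
    (i : Fin m) (k : ℕ) : y (List.replicate k i) = 0 := by
  have h : ∀ ζ : ℂ, ‖ζ‖ < 1 →
      HasSum (fun k => (√(a.coeff k) : ℂ) * y (List.replicate k i) * ζ ^ k) 0 := by
    intro ζ hζ
    have hz : (EuclideanSpace.single i ζ : Cm m) ∈ unitBall m := by simpa [unitBall] using hζ
    have hs := lp.hasSum_inner (𝕜 := ℂ) (a.feature ⟨_, hz⟩) y
    rw [hy, ← Function.Injective.hasSum_iff (g := fun k => List.replicate k i)] at hs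
    · have e : ((fun α => ⟪a.feature ⟨_, hz⟩ α, y α⟫_ℂ) ∘ fun k => List.replicate k i) =
          fun k => (√(a.coeff k) : ℂ) * y (List.replicate k i) * ζ ^ k := by
        funext k
        simp only [Function.comp_apply, RCLike.inner_apply, RadialWeight.feature_apply,
          wordProd_single, List.length_replicate, if_true, map_mul, Complex.conj_ofReal,
          Complex.conj_conj]
        ring
      rw [e] at hs
      exact hs
    · intro k l hkl
      simpa using congrArg List.length hkl
    · intro α hα
      have : α ≠ List.replicate α.length i := fun h => hα ⟨α.length, h.symm⟩
      simp only [RCLike.inner_apply, RadialWeight.feature_apply, wordProd_single, if_neg this,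
        map_zero, mul_zero]
  have h0 := eq_zero_of_hasSum_zero h k
  have : (√(a.coeff k) : ℂ) ≠ 0 := by exact_mod_cast (Real.sqrt_pos.2 (a.pos k)).ne'
  exact (mul_eq_zero.1 h0).resolve_left this

/-- The component `y` of the basis vector orthogonal to the range of `embed` satisfies `‖y‖ ^ 2 = y
(i…i) = 0`. Hence these basis vectors come from the function space, where they can serve as test
vectors. -/
theorem embed_adjoint_embed_basis (hK : RKHS.kernel H = scalarKernel (a.kernel m))
    (i : Fin m) (k : ℕ) :
    a.embed H (adjoint (a.embed H) (basis (List.replicate k i))) =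
      basis (List.replicate k i) := by
  set e : Fock m := basis (List.replicate k i) with he
  set y := e - a.embed H (adjoint (a.embed H) e) with hy
  have hz : adjoint (a.embed H) y = 0 := by
    rw [hy, map_sub, adjoint_embed_embed hK, sub_self]
  have h0 : y (List.replicate k i) = 0 := apply_replicate_eq_zero (a := a) (fun z => by
    rw [← embed_kerVec hK, ← ContinuousLinearMap.adjoint_inner_right, hz, inner_zero_right]) i k
  have h1 : ⟪y, y⟫_ℂ = 0 := by
    nth_rewrite 1 [hy]
    rw [inner_sub_left, ← ContinuousLinearMap.adjoint_inner_right, hz, inner_zero_right, he,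
      inner_basis, h0, sub_zero]
  exact (sub_eq_zero.1 (inner_self_eq_zero.1 h1)).symm

variable (H a) in
/-- The normalized `k`-th power of the `i`-th coordinate. -/
def RadialWeight.coordPow (i : Fin m) (k : ℕ) : H :=
  adjoint (a.embed H) (basis (List.replicate k i))

theorem embed_coordPow (hK : RKHS.kernel H = scalarKernel (a.kernel m)) (i : Fin m) (k : ℕ) :
    a.embed H (a.coordPow H i k) = basis (List.replicate k i) :=
  embed_adjoint_embed_basis hK i k

theorem norm_coordPow (hK : RKHS.kernel H = scalarKernel (a.kernel m))
    (i : Fin m) (k : ℕ) : ‖a.coordPow H i k‖ = 1 := by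
  rw [← norm_embed hK, embed_coordPow hK, norm_basis]

theorem backward_coordPow_succ (hK : RKHS.kernel H = scalarKernel (a.kernel m)) (ha : a.Regular)
    (i : Fin m) (k : ℕ) :
    a.backward H i (a.coordPow H i (k + 1)) =
      (√(a.coeff k / a.coeff (k + 1)) : ℂ) • a.coordPow H i k := by
  rw [RadialWeight.backward, ContinuousLinearMap.comp_apply, ContinuousLinearMap.comp_apply,
    embed_coordPow hK, List.replicate_succ, RadialWeight.lower,
    shift_basis_cons ha.lower_bdd, if_pos rfl, map_smul, List.length_replicate]
  rfl

theorem backward_coordPow_zero (hK : RKHS.kernel H = scalarKernel (a.kernel m)) (ha : a.Regular)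
    (i j : Fin m) : a.backward H j (a.coordPow H i 0) = 0 := by
  rw [RadialWeight.backward, ContinuousLinearMap.comp_apply, ContinuousLinearMap.comp_apply,
    embed_coordPow hK, List.replicate_zero, RadialWeight.lower, shift_basis_nil ha.lower_bdd,
    map_zero]

theorem iterate_backward_coordPow (hK : RKHS.kernel H = scalarKernel (a.kernel m)) (ha : a.Regular)
    (i : Fin m) (k : ℕ) :
    (a.backward H i)^[k] (a.coordPow H i k) =
      (√(a.coeff 0 / a.coeff k) : ℂ) • a.coordPow H i 0 := by
  induction k with
  | zero => simp [div_self (a.pos 0).ne']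
  | succ k ih =>
    have hs : ∀ (c : ℂ) (x : H), (a.backward H i)^[k] (c • x) = c • (a.backward H i)^[k] x := by
      intro c x
      rw [← FunLike.coe_pow_eq_iterate, map_smul]
    rw [Function.iterate_succ_apply, backward_coordPow_succ hK ha, hs, ih, smul_smul,
      ← Complex.ofReal_mul]
    have h0 := a.pos 0
    have h1 := a.pos k
    have h2 := a.pos (k + 1)
    rw [← Real.sqrt_mul (by positivity), mul_comm, div_mul_div_cancel₀ h1.ne']

theorem embed_iterate_backward_nil (hK : RKHS.kernel H = scalarKernel (a.kernel m)) (ha : a.Regular)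
    (i : Fin m) (k : ℕ) (x : H) :
    a.embed H ((a.backward H i)^[k] x) [] =
      √(a.coeff 0 / a.coeff k) * a.embed H x (List.replicate k i) := by
  have h : ∀ k j (x : H), a.embed H ((a.backward H i)^[k] x) (List.replicate j i) =
      √(a.coeff j / a.coeff (j + k)) * a.embed H x (List.replicate (j + k) i) := by
    intro k
    induction k with
    | zero => intro j x; simp [div_self (a.pos j).ne']
    | succ k ih =>
      intro j x
      rw [Function.iterate_succ_apply, ih, embed_backward hK ha, ha.lower_apply,
        List.length_replicate, ← mul_assoc, ← Complex.ofReal_mul]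
      have h0 := a.pos j
      have h1 := a.pos (j + k)
      have h2 := a.pos (j + k + 1)
      rw [← Real.sqrt_mul (by positivity), div_mul_div_cancel₀ h1.ne', add_assoc]
      rfl
  simpa using h k 0 x

/-- The coefficients of a weight whose adjoint tuple is a hypercontraction increase. -/
theorem coeff_le_of_isHypercontraction
    (hK : RKHS.kernel H = scalarKernel (a.kernel m)) (ha : a.Regular)
    (i : Fin m) {n : ℕ} (hn : 0 < n)
    (h : IsHypercontraction n (a.backward H)) (k : ℕ) : a.coeff k ≤ a.coeff (k + 1) := by
  -- Only order one is needed: at the unit vector `coordPow (k + 1)`, the `i`-th term alone equals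
  -- `a(k) / a(k+1)`.
  have hp := (h 1 le_rfl hn).re_inner_nonneg_right (a.coordPow H i (k + 1))
  have e : ((1 - conjugationMap (a.backward H)) ^ 1 : Module.End ℂ (H →L[ℂ] H))
      (ContinuousLinearMap.id ℂ H) =
      ContinuousLinearMap.id ℂ H - ∑ j, adjoint (a.backward H j) ∘L a.backward H j := by
    simp only [pow_one, conjugationMap, LinearMap.sub_apply, Module.End.one_apply,
      LinearMap.sum_apply]
    rfl
  rw [e] at hp
  simp only [_root_.sub_apply, ContinuousLinearMap.id_apply, _root_.sum_apply,
    ContinuousLinearMap.comp_apply, inner_sub_right, inner_sum,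
    ContinuousLinearMap.adjoint_inner_right, inner_self_eq_norm_sq_to_K, norm_coordPow hK] at hp
  have hle : ‖a.backward H i (a.coordPow H i (k + 1))‖ ^ 2 ≤
      ∑ j, ‖a.backward H j (a.coordPow H i (k + 1))‖ ^ 2 :=
    Finset.single_le_sum (f := fun j => ‖a.backward H j (a.coordPow H i (k + 1))‖ ^ 2)
      (fun j _ => by positivity) (Finset.mem_univ i)
  have hp' : ∑ j, ‖a.backward H j (a.coordPow H i (k + 1))‖ ^ 2 ≤ 1 := by
    have e2 : RCLike.re (((1 : ℝ) : ℂ) ^ 2 -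
        ∑ j, ((‖a.backward H j (a.coordPow H i (k + 1))‖ : ℝ) : ℂ) ^ 2) =
        1 - ∑ j, ‖a.backward H j (a.coordPow H i (k + 1))‖ ^ 2 := by
      rw [← RCLike.ofReal_re (K := ℂ) (1 - ∑ j, ‖a.backward H j (a.coordPow H i (k + 1))‖ ^ 2)]
      congr 1
      push_cast
      simp
    have h3 := hp.trans_eq e2
    linarith
  have h1 := hle.trans hp'
  rw [backward_coordPow_succ hK ha, norm_smul, norm_coordPow hK, mul_one, Complex.norm_real,
    Real.norm_of_nonneg (Real.sqrt_nonneg _),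
    Real.sq_sqrt (div_nonneg (a.pos _).le (a.pos _).le), div_le_one (a.pos _)] at h1
  exact h1

/-- Similarity of the adjoint tuples bounds the quotient of the coefficients. -/
theorem coeff_le_of_isSimilar (hK : RKHS.kernel H = scalarKernel (a.kernel m)) (ha : a.Regular)
    {H' : Type*} [NormedAddCommGroup H'] [InnerProductSpace ℂ H']
    [CompleteSpace H'] [RKHS ℂ H' (unitBall m) ℂ] {b : RadialWeight}
    (hK' : RKHS.kernel H' = scalarKernel (b.kernel m)) (hb : b.Regular) (i : Fin m)
    (h : IsSimilar (a.backward H) (b.backward H')) : ∃ C, ∀ k, b.coeff k ≤ C * a.coeff k := by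
  obtain ⟨X, hX⟩ := h
  have hX' : ∀ k x, X ((a.backward H i)^[k] x) = (b.backward H' i)^[k] (X x) := by
    intro k
    induction k with
    | zero => intro x; rfl
    | succ k ih => intro x; rw [Function.iterate_succ_apply, ih, hX, Function.iterate_succ_apply]
  set y := b.embed H' (X (a.coordPow H i 0)) with hy
  -- The intertwiner carries the joint kernel at the origin to the joint kernel at the origin, whose
  -- image in Fock space lives on the empty word.
  have hy0 : y [] ≠ 0 := by
    have hcons : ∀ j α, y (j :: α) = 0 := by
      intro j α
      have h1 : b.lower j y = 0 := by
        rw [hy, ← embed_backward hK' hb, ← hX, backward_coordPow_zero hK ha, map_zero, map_zero]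
      have h2 := hb.lower_apply j y α
      rw [h1] at h2
      have h3 : (√(b.coeff α.length / b.coeff (α.length + 1)) : ℂ) ≠ 0 := by
        exact_mod_cast (Real.sqrt_pos.2 (div_pos (b.pos _) (b.pos _))).ne'
      exact (mul_eq_zero.1 h2.symm).resolve_left h3
    intro h0
    have hy00 : y = 0 := by
      ext α
      cases α with
      | nil => exact h0
      | cons j α => exact hcons j α
    have h1 : ‖y‖ = 0 := by rw [hy00, norm_zero]
    rw [hy, norm_embed hK', norm_eq_zero, map_eq_zero_iff _ X.injective] at h1
    have h2 := norm_coordPow hK (H := H) i 0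
    rw [h1, norm_zero] at h2
    exact zero_ne_one h2
  refine ⟨b.coeff 0 / a.coeff 0 * (‖(X : H →L[ℂ] H')‖ / ‖y []‖) ^ 2, fun k => ?_⟩
  -- Intertwining the `k`-th powers at `coordPow k` and reading off the empty word gives
  -- `√(a(0)/a(k)) * y [] = √(b(0)/b(k)) * (X coordPow k)(i…i)`, whose last factor is at most `‖X‖`.
  have e1 := congrArg (fun x => b.embed H' x []) (hX' k (a.coordPow H i k))
  simp only [iterate_backward_coordPow hK ha, map_smul, smul_apply,
    embed_iterate_backward_nil hK' hb] at e1
  rw [← hy] at e1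
  have e2 := congrArg norm e1
  rw [norm_mul, norm_mul, Complex.norm_real, Complex.norm_real,
    Real.norm_of_nonneg (Real.sqrt_nonneg _), Real.norm_of_nonneg (Real.sqrt_nonneg _)] at e2
  have h1 : ‖b.embed H' (X (a.coordPow H i k)) (List.replicate k i)‖ ≤ ‖(X : H →L[ℂ] H')‖ := by
    refine (lp.norm_apply_le_norm two_ne_zero _ _).trans ?_
    rw [norm_embed hK']
    refine ((X : H →L[ℂ] H').le_opNorm _).trans ?_
    rw [norm_coordPow hK, mul_one]
  have h2 : √(a.coeff 0 / a.coeff k) * ‖y []‖ ≤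
      √(b.coeff 0 / b.coeff k) * ‖(X : H →L[ℂ] H')‖ := by
    rw [e2]
    gcongr
  have h3 := pow_le_pow_left₀ (by positivity) h2 2
  have pa := a.pos 0
  have pb := b.pos 0
  have pak := a.pos k
  have pbk := b.pos k
  have py : 0 < ‖y []‖ := norm_pos_iff.2 hy0
  rw [mul_pow, mul_pow, Real.sq_sqrt (by positivity), Real.sq_sqrt (by positivity)] at h3
  rw [div_mul_eq_mul_div, div_mul_eq_mul_div, div_le_div_iff₀ pak pbk] at h3
  rw [div_pow, div_mul_div_comm, div_mul_eq_mul_div, le_div_iff₀ (by positivity)]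
  linarith

end Monomials

/-! ### The weights -/

section Weights

open Filter Topology

/-- The weight of the kernel `(1 - ⟨z, w⟩) ^ (-(p + 1))`. -/
def hardyWeight (p : ℕ) : RadialWeight where
  coeff := fun i => ((i + p).choose p : ℝ)
  pos := fun i => by exact_mod_cast Nat.choose_pos (Nat.le_add_left p i)
  summable := fun r h0 h1 =>
    summable_choose_mul_geometric_of_norm_lt_one p (by rwa [Real.norm_of_nonneg h0])

theorem hardyKernel_eq (p m : ℕ) : hardyKernel (p + 1) m = (hardyWeight p).kernel m := by
  ext z w
  have h := tsum_choose_mul_geometric_of_norm_lt_one p (norm_inner_lt_one z w)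
  simp only [hardyKernel, RadialWeight.kernel, Matrix.of_apply, hardyWeight]
  rw [← one_div, ← h]
  simp

theorem hardyWeight_succ (p k : ℕ) :
    (hardyWeight p).coeff (k + 1) * (k + 1) = (hardyWeight p).coeff k * (k + p + 1) := by
  have h := Nat.add_one_mul_choose_eq (k + p) k
  rw [Nat.choose_symm_add, show k + p + 1 = k + 1 + p by omega, Nat.choose_symm_add] at h
  simp only [hardyWeight]
  have h' : ((k + 1 + p : ℕ) : ℝ) * ((k + p).choose p : ℕ) =
      ((k + 1 + p).choose p : ℕ) * ((k + 1 : ℕ) : ℝ) := by exact_mod_cast h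
  push_cast at h'
  linarith

theorem hardyWeight_zero (p : ℕ) : (hardyWeight p).coeff 0 = 1 := by simp [hardyWeight]

theorem hardyWeight_mono (p : ℕ) : Monotone (hardyWeight p).coeff :=
  monotone_nat_of_le_succ fun k => by
    have h := hardyWeight_succ p k
    have h0 := (hardyWeight p).pos k
    have hp : (0 : ℝ) ≤ p := p.cast_nonneg
    have hk : (0 : ℝ) < k + 1 := by positivity
    refine le_of_mul_le_mul_right ?_ hk
    rw [h]
    nlinarith

/-- The quotients `(l+p+1)/(l+1)` of successive coefficients decrease in `l`. Submultiplicativity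
lets the weight be its own majorant `A` in `Regular`. -/
theorem hardyWeight_add_le (p k l : ℕ) :
    (hardyWeight p).coeff (k + l) ≤ (hardyWeight p).coeff k * (hardyWeight p).coeff l := by
  induction l with
  | zero => simp [hardyWeight_zero]
  | succ l ih =>
    have h1 := hardyWeight_succ p (k + l)
    have h2 := hardyWeight_succ p l
    have hl : (0 : ℝ) < l + 1 := by positivity
    have hkl : (0 : ℝ) < (k + l : ℕ) + 1 := by positivity
    have hk0 := (hardyWeight p).pos k
    have hl0 := (hardyWeight p).pos l
    rw [← eq_div_iff hkl.ne'] at h1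
    have h2' : (hardyWeight p).coeff (l + 1) =
        (hardyWeight p).coeff l * (l + p + 1) / (l + 1) := by
      rw [eq_div_iff hl.ne', hardyWeight_succ]
    rw [← add_assoc, h1, h2', ← mul_div_assoc, ← mul_assoc, mul_div_assoc, mul_div_assoc]
    refine mul_le_mul ih ?_ (by positivity) (by positivity)
    rw [div_le_div_iff₀ hkl hl]
    push_cast
    have : (0 : ℝ) ≤ p * k := by positivity
    nlinarith

theorem hardyWeight_two_mul_le (p N : ℕ) :
    (hardyWeight p).coeff (2 * N) ≤ 2 ^ p * (hardyWeight p).coeff N := by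
  have key : (2 * N + p).choose p ≤ 2 ^ p * (N + p).choose p := by
    induction p with
    | zero => simp
    | succ p ih =>
      have h1 := Nat.add_one_mul_choose_eq (2 * N + p) p
      have h2 := Nat.add_one_mul_choose_eq (N + p) p
      refine Nat.le_of_mul_le_mul_right (c := p + 1) ?_ p.succ_pos
      calc (2 * N + p + 1).choose (p + 1) * (p + 1)
          = (2 * N + p + 1) * (2 * N + p).choose p := h1.symm
        _ ≤ (2 * (N + p + 1)) * (2 ^ p * (N + p).choose p) := Nat.mul_le_mul (by omega) ih
        _ = 2 ^ (p + 1) * ((N + p + 1) * (N + p).choose p) := by ring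
        _ = 2 ^ (p + 1) * (N + (p + 1)).choose (p + 1) * (p + 1) := by rw [h2]; ring_nf
  simp only [hardyWeight]
  exact_mod_cast key

/-- The hockey-stick identity: `N * b(N)` is comparable to the partial sum of `b`, which transfers
plain averages of `tents` to averages weighted by `b`. -/
theorem mul_hardyWeight (p N : ℕ) :
    N * (hardyWeight p).coeff N = (p + 1) * ∑ k ∈ Finset.range N, (hardyWeight p).coeff k := by
  induction N with
  | zero => simp
  | succ N ih =>
    rw [Finset.sum_range_succ, mul_add, ← ih]
    have := hardyWeight_succ p N
    push_cast
    linarith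

theorem tendsto_hardyWeight_mul_pow (p : ℕ) {t : ℝ} (h0 : 0 ≤ t) (h1 : t < 1) :
    Tendsto (fun l => (hardyWeight p).coeff l * t ^ l) atTop (𝓝 0) :=
  ((hardyWeight p).summable t h0 h1).tendsto_atTop_zero

theorem hardyWeight_regular (p : ℕ) : (hardyWeight p).Regular where
  down := ⟨1, fun k => by simpa using hardyWeight_mono p k.le_succ⟩
  up := ⟨(hardyWeight p).coeff, fun k l => by rw [mul_comm]; exact hardyWeight_add_le p k l,
    fun t h0 h1 => tendsto_hardyWeight_mul_pow p h0 h1⟩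

/-! ### Unbounded 1-Lipschitz spikes with bounded averages -/

/-- The tent of height `j` over the point `16 ^ j`. -/
def tent (j k : ℕ) : ℕ := j - Nat.dist k (16 ^ j)

/-- The supremum of sparse tents of unbounded height. -/
def tents (k : ℕ) : ℕ := (Finset.range (k + 1)).sup fun j => tent j k

theorem tent_le_tents (j k : ℕ) : tent j k ≤ tents k := by
  by_cases h : j < k + 1
  · exact Finset.le_sup (f := fun j => tent j k) (Finset.mem_range.2 h)
  · have h1 : 2 * j ≤ 16 ^ j := by
      have h3 : j < 2 ^ j := Nat.lt_two_pow_self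
      have h4 : 2 ^ j * 2 ^ j ≤ 16 ^ j := by
        rw [← mul_pow]; exact Nat.pow_le_pow_left (by norm_num) j
      nlinarith
    have h2 : tent j k = 0 := by
      unfold tent Nat.dist
      omega
    rw [h2]
    exact Nat.zero_le _

theorem tents_le_of_add_one {k l : ℕ} (h : Nat.dist k l = 1) : tents k ≤ tents l + 1 := by
  refine Finset.sup_le fun j _ => ?_
  have h1 := tent_le_tents j l
  unfold tent Nat.dist at *
  omega

theorem tents_add_le (k l : ℕ) : tents (k + l) ≤ tents k + l := by
  induction l with
  | zero => simp
  | succ l ih =>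
    have := tents_le_of_add_one (k := k + (l + 1)) (l := k + l) (by unfold Nat.dist; omega)
    omega

theorem le_tents (j : ℕ) : j ≤ tents (16 ^ j) := by
  have := tent_le_tents j (16 ^ j)
  unfold tent at this
  simpa [Nat.dist] using this

/-- The tent vanishes before `16 ^ j - j` and has mass at most `2 * j ^ 2`; the base 16 gives `2 ^ j
* j ^ 2 ≤ 16 ^ j - j`. The factor `2 ^ j` makes the bounds summable over `j`. -/
theorem sum_tent_le (j N : ℕ) : 2 ^ j * ∑ k ∈ Finset.range N, tent j k ≤ 2 * N := by
  have h3 : j < 2 ^ j := Nat.lt_two_pow_self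
  by_cases h : N ≤ 16 ^ j - j
  · rw [Finset.sum_eq_zero]
    · simp
    · intro k hk
      rw [Finset.mem_range] at hk
      unfold tent Nat.dist
      omega
  · have h1 : ∑ k ∈ Finset.range N, tent j k ≤ 2 * j * j := by
      calc ∑ k ∈ Finset.range N, tent j k
          ≤ ∑ k ∈ Finset.range N, if k ∈ Finset.Ico (16 ^ j - j) (16 ^ j + j) then j else 0 := by
            refine Finset.sum_le_sum fun k _ => ?_
            split_ifs with hk
            · exact Nat.sub_le _ _
            · rw [Finset.mem_Ico] at hk
              unfold tent Nat.dist
              omega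
        _ ≤ ∑ k ∈ Finset.Ico (16 ^ j - j) (16 ^ j + j), j := by
            rw [← Finset.sum_filter]
            refine Finset.sum_le_sum_of_subset fun k hk => (Finset.mem_filter.1 hk).2
        _ ≤ 2 * j * j := by
            rw [Finset.sum_const, Nat.card_Ico, smul_eq_mul]
            exact Nat.mul_le_mul_right _ (by omega)
    have h4 : 16 ^ j = 2 ^ j * (2 ^ j * (2 ^ j * 2 ^ j)) := by
      rw [← mul_pow, ← mul_pow, ← mul_pow]; norm_num
    generalize hx : 2 ^ j = x at *
    have h5 : j * j ≤ (x - 1) * x := by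
      have : j ≤ x - 1 := by omega
      exact Nat.mul_le_mul this (by omega)
    obtain ⟨y, rfl⟩ : ∃ y, x = y + 1 := ⟨x - 1, by omega⟩
    rw [Nat.add_sub_cancel] at h5
    have h6 : (y + 1) * ((y + 1) * y) + j ≤ 16 ^ j := by
      rw [h4]
      have : j ≤ y := by omega
      have h7 : (y + 1) * ((y + 1) * y) + y ≤ (y + 1) * ((y + 1) * ((y + 1) * (y + 1))) := by
        nlinarith [Nat.zero_le (y ^ 2), Nat.zero_le (y ^ 3), Nat.zero_le (y ^ 4)]
      omega
    calc (y + 1) * ∑ k ∈ Finset.range N, tent j k ≤ (y + 1) * (2 * (y * (y + 1))) := by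
          refine Nat.mul_le_mul_left _ (h1.trans ?_)
          nlinarith
      _ ≤ 2 * N := by
          have : (y + 1) * ((y + 1) * y) ≤ N := by omega
          nlinarith

theorem sum_tents_le (N : ℕ) : ∑ k ∈ Finset.range N, (tents k : ℝ) ≤ 4 * N := by
  calc ∑ k ∈ Finset.range N, (tents k : ℝ)
      ≤ ∑ k ∈ Finset.range N, ∑ j ∈ Finset.range N, (tent j k : ℝ) := by
        refine Finset.sum_le_sum fun k hk => ?_
        have h1 : tents k ≤ ∑ j ∈ Finset.range N, tent j k := by
          refine Finset.sup_le fun j hj => ?_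
          refine Finset.single_le_sum (f := fun j => tent j k) (fun _ _ => Nat.zero_le _) ?_
          rw [Finset.mem_range] at *
          omega
        exact_mod_cast h1
    _ = ∑ j ∈ Finset.range N, ∑ k ∈ Finset.range N, (tent j k : ℝ) := Finset.sum_comm
    _ ≤ ∑ j ∈ Finset.range N, 2 * N * (1 / 2 : ℝ) ^ j := by
        refine Finset.sum_le_sum fun j _ => ?_
        have h := sum_tent_le j N
        have h' : (2 : ℝ) ^ j * ∑ k ∈ Finset.range N, (tent j k : ℝ) ≤ 2 * N := by exact_mod_cast h
        rw [one_div, inv_pow, ← div_eq_mul_inv, le_div_iff₀ (by positivity)]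
        linarith
    _ = 2 * N * ∑ j ∈ Finset.range N, (1 / 2 : ℝ) ^ j := by rw [Finset.mul_sum]
    _ ≤ 2 * N * 2 := by gcongr; exact sum_geometric_two_le N
    _ = 4 * N := by ring

/-- Domination of partial sums carries over to power series. -/
theorem pow_mul_sum_le_sum_mul_pow {x : ℕ → ℝ} (hx : ∀ N, 0 ≤ ∑ k ∈ Finset.range N, x k) {r : ℝ}
    (h0 : 0 ≤ r) (h1 : r ≤ 1) (N : ℕ) :
    r ^ N * ∑ k ∈ Finset.range N, x k ≤ ∑ k ∈ Finset.range N, x k * r ^ k := by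
  induction N with
  | zero => simp
  | succ N ih =>
    rw [Finset.sum_range_succ (fun k => x k * r ^ k)]
    -- Abel summation in inductive form: nonnegativity of the next partial sum allows one factor `r`
    -- to be dropped.
    have h2 : r ^ (N + 1) * ∑ k ∈ Finset.range (N + 1), x k ≤
        r ^ N * ∑ k ∈ Finset.range (N + 1), x k :=
      mul_le_mul_of_nonneg_right (pow_le_pow_of_le_one h0 h1 N.le_succ) (hx _)
    rw [Finset.sum_range_succ, mul_add (r ^ N)] at h2
    rw [Finset.sum_range_succ]
    linarith

/-! ### The spiked weight -/

/-- The coefficients of the perturbed weight. -/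
def spikedCoeff (p k : ℕ) : ℝ := (hardyWeight p).coeff k * (1 + tents k)

theorem spikedCoeff_pos (p k : ℕ) : 0 < spikedCoeff p k :=
  mul_pos ((hardyWeight p).pos k) (by positivity)

/-- The constant is `1 + 4 * (p + 1)`: 4 bounds the averages of `tents`, and `p + 1` comes from
`mul_hardyWeight`. -/
theorem sum_spikedCoeff_le (p N : ℕ) : ∑ k ∈ Finset.range N, spikedCoeff p k ≤
    (4 * p + 5) * ∑ k ∈ Finset.range N, (hardyWeight p).coeff k := by
  have h1 : ∑ k ∈ Finset.range N, (hardyWeight p).coeff k * tents k ≤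
      (hardyWeight p).coeff N * (4 * N) := by
    calc _ ≤ ∑ k ∈ Finset.range N, (hardyWeight p).coeff N * tents k := by
          refine Finset.sum_le_sum fun k hk => ?_
          exact mul_le_mul_of_nonneg_right (hardyWeight_mono p (Finset.mem_range.1 hk).le)
            (Nat.cast_nonneg _)
      _ = (hardyWeight p).coeff N * ∑ k ∈ Finset.range N, (tents k : ℝ) := by
          rw [Finset.mul_sum]
      _ ≤ _ := mul_le_mul_of_nonneg_left (sum_tents_le N) ((hardyWeight p).pos N).le
  have h2 := mul_hardyWeight p N
  simp only [spikedCoeff, mul_add, mul_one, Finset.sum_add_distrib]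
  linarith

theorem sum_spikedCoeff_mul_pow_le (p N : ℕ) {r : ℝ} (h0 : 0 ≤ r) (h1 : r < 1) :
    ∑ k ∈ Finset.range N, spikedCoeff p k * r ^ k ≤
      (4 * p + 5) * ∑' k, (hardyWeight p).coeff k * r ^ k := by
  have hx : ∀ N, 0 ≤ ∑ k ∈ Finset.range N,
      ((4 * p + 5) * (hardyWeight p).coeff k - spikedCoeff p k) := fun N => by
    rw [Finset.sum_sub_distrib, ← Finset.mul_sum, sub_nonneg]
    exact sum_spikedCoeff_le p N
  have h := pow_mul_sum_le_sum_mul_pow hx h0 h1.le N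
  have h2 := (mul_nonneg (pow_nonneg h0 N) (hx N)).trans h
  simp only [sub_mul, Finset.sum_sub_distrib, mul_assoc, ← Finset.mul_sum] at h2
  have h3 := ((hardyWeight p).summable r h0 h1).sum_le_tsum (Finset.range N)
    (fun k _ => mul_nonneg ((hardyWeight p).pos k).le (pow_nonneg h0 k))
  have h4 : (0 : ℝ) ≤ 4 * p + 5 := by positivity
  nlinarith

/-- The Hardy weight perturbed by sparse slowly varying spikes. -/
def spikedWeight (p : ℕ) : RadialWeight where
  coeff := spikedCoeff p
  pos := spikedCoeff_pos p
  summable := fun _ h0 h1 => summable_of_sum_range_le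
    (fun k => mul_nonneg (spikedCoeff_pos p k).le (pow_nonneg h0 k))
    (fun N => sum_spikedCoeff_mul_pow_le p N h0 h1)

theorem tsum_spikedWeight_le (p : ℕ) {r : ℝ} (h0 : 0 ≤ r) (h1 : r < 1) :
    ∑' k, (spikedWeight p).coeff k * r ^ k ≤
      (4 * p + 5) * ∑' k, (hardyWeight p).coeff k * r ^ k :=
  Real.tsum_le_of_sum_range_le
    (fun k => mul_nonneg (spikedCoeff_pos p k).le (pow_nonneg h0 k))
    (fun N => sum_spikedCoeff_mul_pow_le p N h0 h1)

theorem hardyWeight_le_spikedWeight (p k : ℕ) :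
    (hardyWeight p).coeff k ≤ (spikedWeight p).coeff k :=
  le_mul_of_one_le_right ((hardyWeight p).pos k).le (by simp)

theorem tsum_hardyWeight_le (p : ℕ) {r : ℝ} (h0 : 0 ≤ r) (h1 : r < 1) :
    ∑' k, (hardyWeight p).coeff k * r ^ k ≤ ∑' k, (spikedWeight p).coeff k * r ^ k :=
  ((hardyWeight p).summable r h0 h1).tsum_le_tsum
    (fun k => mul_le_mul_of_nonneg_right (hardyWeight_le_spikedWeight p k) (pow_nonneg h0 k))
    ((spikedWeight p).summable r h0 h1)

theorem spikedWeight_regular (p : ℕ) : (spikedWeight p).Regular where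
  down := ⟨2, fun k => by
    have h1 : tents k ≤ tents (k + 1) + 1 := tents_le_of_add_one (by unfold Nat.dist; omega)
    have h1' : (tents k : ℝ) ≤ tents (k + 1) + 1 := by exact_mod_cast h1
    have h2 : (0 : ℝ) ≤ tents (k + 1) := Nat.cast_nonneg _
    calc (hardyWeight p).coeff k * (1 + tents k)
        ≤ (hardyWeight p).coeff (k + 1) * (2 * (1 + tents (k + 1))) :=
          mul_le_mul (hardyWeight_mono p k.le_succ) (by linarith) (by positivity)
            ((hardyWeight p).pos _).le
      _ = 2 * ((hardyWeight p).coeff (k + 1) * (1 + tents (k + 1))) := by ring⟩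
  up := by
    refine ⟨fun l => (hardyWeight p).coeff l * (1 + l), fun k l => ?_, fun t h0 h1 => ?_⟩
    · have h1' : (tents (k + l) : ℝ) ≤ tents k + l := by exact_mod_cast tents_add_le k l
      have h2 : (0 : ℝ) ≤ tents k * l := by positivity
      calc (hardyWeight p).coeff (k + l) * (1 + tents (k + l))
          ≤ ((hardyWeight p).coeff k * (hardyWeight p).coeff l) * ((1 + tents k) * (1 + l)) :=
            mul_le_mul (hardyWeight_add_le p k l) (by linarith) (by positivity)
              (mul_nonneg ((hardyWeight p).pos _).le ((hardyWeight p).pos _).le)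
        _ = (hardyWeight p).coeff l * (1 + l) * ((hardyWeight p).coeff k * (1 + tents k)) := by
            ring
    · have hs : √t < 1 := by rwa [Real.sqrt_lt' one_pos, one_pow]
      have ha := tendsto_hardyWeight_mul_pow p (Real.sqrt_nonneg t) hs
      have hb := tendsto_hardyWeight_mul_pow 1 (Real.sqrt_nonneg t) hs
      have hab := ha.mul hb
      rw [mul_zero] at hab
      refine hab.congr fun l => ?_
      have e : (hardyWeight 1).coeff l = 1 + l := by simp [hardyWeight, add_comm]
      rw [e]
      calc _ = (hardyWeight p).coeff l * (1 + l) * (√t * √t) ^ l := by rw [mul_pow]; ring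
        _ = _ := by rw [Real.mul_self_sqrt h0]

theorem not_spikedWeight_le (p : ℕ) :
    ¬ ∃ C, ∀ k, (spikedWeight p).coeff k ≤ C * (hardyWeight p).coeff k := by
  rintro ⟨C, hC⟩
  obtain ⟨j, hj⟩ := exists_nat_gt C
  have h := hC (16 ^ j)
  have h1 : (hardyWeight p).coeff (16 ^ j) * (1 + tents (16 ^ j)) ≤
      C * (hardyWeight p).coeff (16 ^ j) := h
  rw [mul_comm C] at h1
  have h2 := le_of_mul_le_mul_left h1 ((hardyWeight p).pos _)
  have h3 : (j : ℝ) ≤ tents (16 ^ j) := by exact_mod_cast le_tents j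
  linarith

theorem not_monotone_spikedWeight (p : ℕ) :
    ¬ ∀ k, (spikedWeight p).coeff k ≤ (spikedWeight p).coeff (k + 1) := by
  intro hmono
  have hm := monotone_nat_of_le_succ hmono
  -- Under monotonicity, `N * a(N)` is at most the sum of `a` over `[N, 2N)`, hence at most `(4p+5)
  -- * 2N * b(2N)`, and doubling costs `2 ^ p`. The case `N = 0` is separate because `N` is
  -- cancelled.
  refine not_spikedWeight_le p ⟨(4 * p + 5) * (2 * 2 ^ p), fun N => ?_⟩
  rcases Nat.eq_zero_or_pos N with rfl | hN
  · have h0 : tents 0 = 0 := by simp [tents, tent]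
    have h2 : (1 : ℝ) ≤ 2 ^ p := one_le_pow₀ (by norm_num)
    have hp : (0 : ℝ) ≤ p := p.cast_nonneg
    change (hardyWeight p).coeff 0 * (1 + tents 0) ≤ _
    rw [h0, hardyWeight_zero]
    push_cast
    nlinarith
  · have hN' : (0 : ℝ) < N := by exact_mod_cast hN
    have h1 : N * (spikedWeight p).coeff N ≤
        ∑ k ∈ Finset.range (2 * N), (spikedWeight p).coeff k := by
      rw [two_mul, Finset.sum_range_add]
      have h2 : N * (spikedWeight p).coeff N ≤
          ∑ k ∈ Finset.range N, (spikedWeight p).coeff (N + k) := by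
        have := Finset.card_nsmul_le_sum (Finset.range N)
          (fun k => (spikedWeight p).coeff (N + k)) ((spikedWeight p).coeff N)
          (fun k _ => hm (Nat.le_add_right N k))
        simpa using this
      have h3 : 0 ≤ ∑ k ∈ Finset.range N, (spikedWeight p).coeff k :=
        Finset.sum_nonneg fun k _ => ((spikedWeight p).pos k).le
      linarith
    have h2 : ∑ k ∈ Finset.range (2 * N), (hardyWeight p).coeff k ≤
        2 * N * (hardyWeight p).coeff (2 * N) := by
      have h3 := Finset.sum_le_card_nsmul (Finset.range (2 * N)) (hardyWeight p).coeff
        ((hardyWeight p).coeff (2 * N))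
        (fun k hk => hardyWeight_mono p (Finset.mem_range.1 hk).le)
      simpa using h3
    have h3 := hardyWeight_two_mul_le p N
    have h4 := h1.trans (sum_spikedCoeff_le p (2 * N))
    have hp : (0 : ℝ) ≤ 4 * p + 5 := by positivity
    refine le_of_mul_le_mul_left ?_ hN'
    calc _ ≤ _ := h4
      _ ≤ (4 * p + 5) * (2 * N * (2 ^ p * (hardyWeight p).coeff N)) := by
        gcongr
        exact h2.trans (by gcongr)
      _ = _ := by ring

end Weights

/-! ### Curvature -/

section CurvatureComparison

open scoped ContDiff
open ContinuousLinearMap (adjoint)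

variable {m : ℕ}

theorem wirtinger_congr {f g : Cm m → ℂ} {w : Cm m} (h : f =ᶠ[nhds w] g) (i : Fin m) :
    wirtinger i f w = wirtinger i g w := by
  rw [wirtinger, wirtinger, h.fderiv_eq]

theorem wirtinger_sub {f g : Cm m → ℂ} {w : Cm m} (hf : DifferentiableAt ℝ f w)
    (hg : DifferentiableAt ℝ g w) (i : Fin m) :
    wirtinger i (fun v => f v - g v) w = wirtinger i f w - wirtinger i g w := by
  simp only [wirtinger, fderiv_fun_sub hf hg, _root_.sub_apply]
  ring

theorem wirtingerBar_const_add_sub {f g : Cm m → ℂ} {w : Cm m} (hf : DifferentiableAt ℝ f w)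
    (hg : DifferentiableAt ℝ g w) (c : ℂ) (j : Fin m) :
    wirtingerBar j (fun v => c + f v - g v) w = wirtingerBar j f w - wirtingerBar j g w := by
  have h : fderiv ℝ (fun v => c + f v - g v) w = fderiv ℝ f w - fderiv ℝ g w := by
    rw [fderiv_fun_sub (hf.const_add c) hg, fderiv_const_add]
  simp only [wirtingerBar, h, _root_.sub_apply]
  ring

theorem differentiableAt_wirtingerBar {f : Cm m → ℂ} {w : Cm m} (hf : ContDiffAt ℝ 2 f w)
    (j : Fin m) : DifferentiableAt ℝ (wirtingerBar j f) w := by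
  have h : DifferentiableAt ℝ (fderiv ℝ f) w :=
    (hf.fderiv_right (m := 1) (by norm_num)).differentiableAt (by norm_num)
  unfold wirtingerBar
  fun_prop

theorem ddbar_const_add_sub {u v : Cm m → ℝ} {s : Set (Cm m)} (hs : IsOpen s)
    (hu : ∀ x ∈ s, ContDiffAt ℝ 2 u x) (hv : ∀ x ∈ s, ContDiffAt ℝ 2 v x) (c : ℝ) {w : Cm m}
    (hw : w ∈ s) : ddbar (fun x => c + u x - v x) w = ddbar u w - ddbar v w := by
  have hu' : ∀ x ∈ s, ContDiffAt ℝ 2 (fun y => (u y : ℂ)) x := fun x hx =>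
    Complex.ofRealCLM.contDiff.contDiffAt.comp x (hu x hx)
  have hv' : ∀ x ∈ s, ContDiffAt ℝ 2 (fun y => (v y : ℂ)) x := fun x hx =>
    Complex.ofRealCLM.contDiff.contDiffAt.comp x (hv x hx)
  funext ξ η
  simp only [ddbar, Pi.sub_apply, ← Finset.sum_sub_distrib]
  refine Finset.sum_congr rfl fun i _ => Finset.sum_congr rfl fun j _ => ?_
  rw [← sub_mul, ← wirtinger_sub (differentiableAt_wirtingerBar (hu' w hw) j)
    (differentiableAt_wirtingerBar (hv' w hw) j)]
  congr 1
  refine wirtinger_congr ?_ i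
  filter_upwards [hs.mem_nhds hw] with x hx
  have := wirtingerBar_const_add_sub ((hu' x hx).differentiableAt (by norm_num))
    ((hv' x hx).differentiableAt (by norm_num)) c j
  rw [← this]
  congr 1
  funext y
  push_cast
  rfl

theorem RadialWeight.analyticAt_tsum (a : RadialWeight) {t : ℝ} (ht : |t| < 1) :
    AnalyticAt ℝ (fun t : ℝ => ∑' k, a.coeff k * t ^ k) t := by
  set p := FormalMultilinearSeries.ofScalars ℝ a.coeff with hp
  have hr : 1 ≤ p.radius := by
    refine ENNReal.le_of_forall_nnreal_lt fun r hr => ?_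
    refine p.le_radius_of_summable_norm ?_
    have hr' : (r : ℝ) < 1 := by exact_mod_cast hr
    refine (a.summable r r.2 hr').congr fun k => ?_
    rw [hp, FormalMultilinearSeries.ofScalars_norm, Real.norm_of_nonneg (a.pos k).le]
  have h := p.hasFPowerSeriesOnBall (one_pos.trans_le hr)
  have e : p.sum = fun t : ℝ => ∑' k, a.coeff k * t ^ k := by
    funext t
    exact FormalMultilinearSeries.ofScalars_sum_eq (E := ℝ) a.coeff t
  rw [← e]
  refine h.analyticAt_of_mem (Metric.eball_subset_eball hr ?_)
  simpa [← ofReal_norm, ENNReal.ofReal_lt_one] using ht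

theorem RadialWeight.tsum_pos (a : RadialWeight) {t : ℝ} (h0 : 0 ≤ t) (h1 : t < 1) :
    0 < ∑' k, a.coeff k * t ^ k :=
  (a.summable t h0 h1).tsum_pos (fun k => mul_nonneg (a.pos k).le (pow_nonneg h0 k)) 0
    (by simpa using a.pos 0)

theorem norm_sq_lt_one {w : Cm m} (hw : w ∈ unitBall m) : ‖w‖ ^ 2 < 1 := by
  have hw' : ‖w‖ < 1 := by simpa [unitBall] using hw
  exact pow_lt_one₀ (norm_nonneg _) hw' two_ne_zero

theorem isOpen_unitBall : IsOpen (unitBall m) := Metric.isOpen_ball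

variable {H : Type*} [NormedAddCommGroup H] [InnerProductSpace ℂ H] [CompleteSpace H]
  [RKHS ℂ H (unitBall m) ℂ] {a : RadialWeight}

/-- The squared norm is a positive power series in the real polynomial `‖v‖ ^ 2`. -/
theorem analyticAt_log_norm_kernelSection (hK : RKHS.kernel H = scalarKernel (a.kernel m))
    (ha : a.Regular) {w : Cm m} (hw : w ∈ unitBall m) :
    AnalyticAt ℝ (fun v => Real.log (‖a.kernelSection H v‖ ^ 2)) w := by
  have h1 : AnalyticAt ℝ (fun v : Cm m => ‖v‖ ^ 2) w :=
    (contDiff_norm_sq ℂ (n := ω)).contDiffAt.analyticAt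
  have h2 : AnalyticAt ℝ (fun v : Cm m => ∑' k, a.coeff k * (‖v‖ ^ 2) ^ k) w := by
    refine AnalyticAt.fun_comp (g := fun t : ℝ => ∑' k, a.coeff k * t ^ k) (a.analyticAt_tsum ?_) h1
    rw [abs_of_nonneg (by positivity)]
    exact norm_sq_lt_one hw
  have h3 := (h2.contDiffAt (n := ω)).log
    (a.tsum_pos (by positivity) (norm_sq_lt_one hw)).ne'
  refine h3.analyticAt.congr ?_
  filter_upwards [isOpen_unitBall.mem_nhds hw] with v hv
  rw [norm_kernelSection_sq hK ha hv]

/-- For comparable kernels the curvatures differ by the Levi form of a bounded positive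
function. -/
theorem exists_curvature_potential {H' : Type*} [NormedAddCommGroup H'] [InnerProductSpace ℂ H']
    [CompleteSpace H'] [RKHS ℂ H' (unitBall m) ℂ] {b : RadialWeight}
    (hK : RKHS.kernel H = scalarKernel (a.kernel m)) (ha : a.Regular)
    (hK' : RKHS.kernel H' = scalarKernel (b.kernel m)) (hb : b.Regular)
    (hle : ∀ r : ℝ, 0 ≤ r → r < 1 → ∑' k, b.coeff k * r ^ k ≤ ∑' k, a.coeff k * r ^ k)
    {C : ℝ} (hC : 0 < C)
    (hge : ∀ r : ℝ, 0 ≤ r → r < 1 → ∑' k, a.coeff k * r ^ k ≤ C * ∑' k, b.coeff k * r ^ k) :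
    ∃ φ : Cm m → ℝ,
      AnalyticOnNhd ℝ φ (unitBall m) ∧
      (∀ w ∈ unitBall m, 0 < φ w) ∧
      (∃ C : ℝ, ∀ w ∈ unitBall m, φ w ≤ C) ∧
      ∃ κS κT : Cm m → Cm m → Cm m → ℂ,
        IsCurvature (b.backward H') (unitBall m) κS ∧
        IsCurvature (a.backward H) (unitBall m) κT ∧
        ∀ w ∈ unitBall m, κS w - κT w = ddbar φ w := by
  -- The comparison `hle` only makes the logarithm of the quotient nonnegative; the added 1,
  -- invisible to `ddbar`, makes it positive.
  refine ⟨fun v => 1 + Real.log (‖a.kernelSection H v‖ ^ 2) -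
    Real.log (‖b.kernelSection H' v‖ ^ 2), fun w hw => ?_, fun w hw => ?_,
    ⟨1 + Real.log C, fun w hw => ?_⟩,
    fun w => -ddbar (fun v => Real.log (‖b.kernelSection H' v‖ ^ 2)) w,
    fun w => -ddbar (fun v => Real.log (‖a.kernelSection H v‖ ^ 2)) w,
    ⟨_, isNonvanishingSection_kernelSection hK' hb, fun w _ => rfl⟩,
    ⟨_, isNonvanishingSection_kernelSection hK ha, fun w _ => rfl⟩, fun w hw => ?_⟩
  · exact (analyticAt_const.add (analyticAt_log_norm_kernelSection hK ha hw)).sub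
      (analyticAt_log_norm_kernelSection hK' hb hw)
  · have h := Real.log_le_log (b.tsum_pos (by positivity) (norm_sq_lt_one hw))
      (hle (‖w‖ ^ 2) (by positivity) (norm_sq_lt_one hw))
    simp only [norm_kernelSection_sq hK ha hw, norm_kernelSection_sq hK' hb hw]
    linarith
  · have hpos := b.tsum_pos (t := ‖w‖ ^ 2) (by positivity) (norm_sq_lt_one hw)
    have h := Real.log_le_log (a.tsum_pos (by positivity) (norm_sq_lt_one hw))
      (hge (‖w‖ ^ 2) (by positivity) (norm_sq_lt_one hw))
    rw [Real.log_mul hC.ne' hpos.ne'] at h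
    simp only [norm_kernelSection_sq hK ha hw, norm_kernelSection_sq hK' hb hw]
    linarith
  · rw [ddbar_const_add_sub isOpen_unitBall
      (fun x hx => (analyticAt_log_norm_kernelSection hK ha hx).contDiffAt)
      (fun x hx => (analyticAt_log_norm_kernelSection hK' hb hx).contDiffAt) 1 hw]
    exact neg_sub_neg _ _

end CurvatureComparison

end

theorem mainTheorem5 (n m : ℕ) (hn : 0 < n) (hm : 0 < m) :
    ∃ S : Fin m → HardySpace n m →L[ℂ] HardySpace n m,
      IsCoordinateMultiplication S ∧
      CowenDouglas 1 (unitBall m) (adjointTuple S) ∧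
      ∃ (a : RadialWeight) (M T : Fin m → a.Space m →L[ℂ] a.Space m),
        IsCoordinateMultiplication M ∧
        T = adjointTuple M ∧
        CowenDouglas 1 (unitBall m) T ∧
        ¬ IsHypercontraction n T ∧
        (∃ φ : Cm m → ℝ,
          AnalyticOnNhd ℝ φ (unitBall m) ∧
          (∀ w ∈ unitBall m, 0 < φ w) ∧
          (∃ C : ℝ, ∀ w ∈ unitBall m, φ w ≤ C) ∧
          ∃ κS κT : Cm m → Cm m → Cm m → ℂ,
            IsCurvature (adjointTuple S) (unitBall m) κS ∧
            IsCurvature T (unitBall m) κT ∧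
            ∀ w ∈ unitBall m, κS w - κT w = ddbar φ w) ∧
        ¬ IsSimilar T (adjointTuple S) := by
  obtain ⟨p, rfl⟩ : ∃ p, n = p + 1 := ⟨n - 1, by omega⟩
  have hb := hardyWeight_regular p
  have ha := spikedWeight_regular p
  have hK' : RKHS.kernel (HardySpace (p + 1) m) = scalarKernel ((hardyWeight p).kernel m) := by
    rw [RKHS.OfKernel.kernel_ofKernel, hardyKernel_eq]
  have hK : RKHS.kernel ((spikedWeight p).Space m) = scalarKernel ((spikedWeight p).kernel m) :=
    RKHS.OfKernel.kernel_ofKernel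
  refine ⟨_, isCoordinateMultiplication_adjoint_backward hK' hb, ?_, spikedWeight p, _,
    (spikedWeight p).backward ((spikedWeight p).Space m),
    isCoordinateMultiplication_adjoint_backward hK ha, adjointTuple_adjoint_backward.symm,
    cowenDouglas_backward hK ha, fun h => ?_, ?_, fun h => ?_⟩
  · rw [adjointTuple_adjoint_backward]
    exact cowenDouglas_backward hK' hb
  · exact not_monotone_spikedWeight p (coeff_le_of_isHypercontraction hK ha ⟨0, hm⟩ hn h)
  · rw [adjointTuple_adjoint_backward]
    exact exists_curvature_potential hK ha hK' hb (fun r h0 h1 => tsum_hardyWeight_le p h0 h1)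
      (C := 4 * p + 5) (by positivity) (fun r h0 h1 => tsum_spikedWeight_le p h0 h1)
  · rw [adjointTuple_adjoint_backward] at h
    -- The direction matters: a similarity from the Hardy tuple to the spiked one bounds the spiked
    -- coefficients by the Hardy ones.
    exact not_spikedWeight_le p (coeff_le_of_isSimilar hK' hb hK ha ⟨0, hm⟩ h.symm)
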